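/- Let $\mathcal H$ be a complex Hilbert space (not necessarily separable), with inner product antilinear in the first variable. A CAR-algebra of $\mathcal H$ is a nonzero unital $C^*$-algebra $\mathrm{CAR}(\mathcal H)$ together with a continuous antilinear map $a:\mathcal H\to \mathrm{CAR}(\mathcal H)$ whose image generates $\mathrm{CAR}(\mathcal H)$ as a unital $C^*$-algebra and which satisfies $$a(f)a(g)^*+a(g)^*a(f)=\langle f,g\rangle \mathbf 1,\qquad a(f)a(g)+a(g)a(f)=0\qquad (f,g\in\mathcal H).$$ There is a unique action $\alpha:\mathrm U(\mathcal H)\to \mathrm{Aut}\,\mathrm{CAR}(\mathcal H)$ of the unitary group $\mathrm U(\mathcal H)$ by $*$-automorphisms such that $\alpha_U(a(f))=a(Uf)$ for all $U\in \mathrm U(\mathcal H)$ and $f\in\mathcal H$. For a set $\mathcal S\subseteq B(\mathcal H)$ of bounded operators put $\mathrm U(\mathcal S):=\mathrm U(\mathcal H)\cap\mathcal S$ and $$\mathrm{CAR}(\mathcal H)^{\mathrm U(\mathcal S)}:=\{A\in \mathrm{CAR}(\mathcal H) : \alpha_U(A)=A \text{ for all } U\in \mathrm U(\mathcal S)\}.$$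 Let $\mathcal A\subseteq B(\mathcal H)$ be a $C^*$-subalgebra (a norm-closed $*$-subalgebra) containing the identity operator, and let $\mathcal A''$ be its bicommutant. Then $$\mathrm{CAR}(\mathcal H)^{\mathrm U(\mathcal A)}=\mathrm{CAR}(\mathcal H)^{\mathrm U(\mathcal A'')}.$$ If moreover $\mathcal A''$ contains a non-atomic commutative von Neumann algebra $\mathcal N\subseteq B(\mathcal H)$ (that is, a commutative $*$-subalgebra with $\mathcal N=\mathcal N''$, so in particular containing the identity operator, which has no minimal nonzero projection), then $$\mathrm{CAR}(\mathcal H)^{\mathrm U(\mathcal A)}=\mathbb C\mathbf 1.$$ -/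

import Mathlib

open scoped InnerProductSpace

namespace CARAlg

universe u v

/-- A CAR-algebra of the complex Hilbert space `H`: a (nonzero, unital) C⋆-algebra `A` with a
continuous antilinear map `a : H → A` whose image generates `A` as a unital C⋆-algebra and which
satisfies the canonical anticommutation relations. The inner product `⟪f, g⟫_ℂ` is antilinear in
its first variable `f`, as is `a f`. -/
structure IsCARAlgebra {H : Type u} [NormedAddCommGroup H] [InnerProductSpace ℂ H]
    {A : Type v} [CStarAlgebra A] (a : H →L⋆[ℂ] A) : Prop where
  nontrivial : Nontrivial A
  anticomm_star : ∀ f g : H, a f * star (a g) + star (a g) * a f = ⟪f, g⟫_ℂ • (1 : A)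
  anticomm : ∀ f g : H, a f * a g + a g * a f = 0
  generates : (StarAlgebra.adjoin ℂ (Set.range a)).topologicalClosure = ⊤

/-- `α` is the canonical action of the unitary group `U(H)` by ⋆-automorphisms of `CAR(H)`:
`α_U (a f) = a (U f)`. -/
def IsCanonicalAction {H : Type u} [NormedAddCommGroup H] [InnerProductSpace ℂ H]
    [CompleteSpace H] {A : Type v} [CStarAlgebra A] (a : H →L⋆[ℂ] A)
    (α : unitary (H →L[ℂ] H) →* (A ≃⋆ₐ[ℂ] A)) : Prop :=
  ∀ (U : unitary (H →L[ℂ] H)) (f : H), α U (a f) = a ((U : H →L[ℂ] H) f)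

/-- The fixed point algebra of the unitaries that lie in the set `S` of bounded operators,
under an action `α` of `U(H)` on `A`. -/
def fixedPointAlgebra {H : Type u} [NormedAddCommGroup H] [InnerProductSpace ℂ H]
    [CompleteSpace H] {A : Type v} [CStarAlgebra A]
    (α : unitary (H →L[ℂ] H) →* (A ≃⋆ₐ[ℂ] A)) (S : Set (H →L[ℂ] H)) :
    StarSubalgebra ℂ A where
  carrier := {x | ∀ U : unitary (H →L[ℂ] H), (U : H →L[ℂ] H) ∈ S → α U x = x}
  mul_mem' hx hy U hU := by rw [map_mul, hx U hU, hy U hU]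
  add_mem' hx hy U hU := by rw [map_add, hx U hU, hy U hU]
  algebraMap_mem' c U _ := by
    rw [Algebra.algebraMap_eq_smul_one, map_smul, map_one]
  star_mem' hx U hU := by rw [map_star, hx U hU]

/-- The bicommutant `S''` of a set of bounded operators. -/
def bicommutant {H : Type u} [NormedAddCommGroup H] [InnerProductSpace ℂ H]
    (S : Set (H →L[ℂ] H)) : Set (H →L[ℂ] H) :=
  Set.centralizer (Set.centralizer S)

/-- `p` is a minimal nonzero projection of the von Neumann algebra `N`. For projections,
`q ≤ p` means `p * q = q`. -/
def IsMinimalProjection {H : Type u} [NormedAddCommGroup H] [InnerProductSpace ℂ H]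
    [CompleteSpace H] (N : VonNeumannAlgebra H) (p : H →L[ℂ] H) : Prop :=
  p ∈ N ∧ IsStarProjection p ∧ p ≠ 0 ∧
    ∀ q ∈ N, IsStarProjection q → p * q = q → q = 0 ∨ q = p

/-- `N` is non-atomic: it contains no minimal nonzero projection. -/
def IsNonatomic {H : Type u} [NormedAddCommGroup H] [InnerProductSpace ℂ H]
    [CompleteSpace H] (N : VonNeumannAlgebra H) : Prop :=
  ¬ ∃ p : H →L[ℂ] H, IsMinimalProjection N p

/-- `N` is commutative. -/
def IsCommutative {H : Type u} [NormedAddCommGroup H] [InnerProductSpace ℂ H]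
    [CompleteSpace H] (N : VonNeumannAlgebra H) : Prop :=
  ∀ x ∈ N, ∀ y ∈ N, x * y = y * x

end CARAlg

/-!
The action. Over finitely many orthonormal modes, a finite composition of averages
`x ↦ (x + p x p) / 2` over self-adjoint unitaries `p` maps the polynomials in the `a f` to scalars
(`SatisfiesCAR.exists_averageList`). Such averages commute with `*`-homomorphisms and are faithful
on positive elements, so all unital `*`-homomorphisms are isometric on polynomials
(`SatisfiesCAR.norm_map_eq`); they are contractions that fix central elements, so the center of a
CAR-algebra is trivial (`SatisfiesCAR.mem_bot_of_forall_commute`). The isomorphism of two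
CAR-algebras of the same Hilbert space is obtained as a graph in their product
(`SatisfiesCAR.exists_starAlgEquiv`); applied to `a` and `a ∘ U` it gives the automorphism `α_U`.

Fixed points of `U(𝒜)` and `U(𝒜'')`. The action is strongly continuous, so it suffices that `U(𝒜)`
is strongly dense in `U(𝒜'')` (`exists_unitary_approx_of_mem_bicommutant`). Given a unitary
`V ∈ 𝒜''`, the double commutant theorem, with `x` and `x⋆` treated simultaneously, gives `k ∈ 𝒜`
that is `*`-strongly close to `V`; then `2 k (1 + k⋆ k)⁻¹` is a contraction of `𝒜` close to `V`.
By the theorem of Russo and Dye it is nearly a mean of unitaries of `𝒜`, and by strict convexity one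
of them is close to `V`.

The non-atomic case. A non-atomic von Neumann algebra `N` has self-adjoint unitaries whose matrix
coefficients at finitely many given vectors are arbitrarily small (`hasSmallSymmetry_one`):
otherwise Zorn's lemma gives a minimal projection below which this fails, and non-atomicity splits
it. If `U` tends weakly to zero, then `α_U x` asymptotically commutes with every `a g`, up to the
grading. A fixed point of `U(N)` is even since `-1 ∈ N`, so it commutes with every `a g`, is
central, and hence is a scalar.
-/

open Filter Topology

/-! ### Means of unitaries in a C⋆-algebra -/

/-- The element `(U + y) / 2 = U (1 + U⋆ y) / 2` is an invertible contraction. By polar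
decomposition it is a unitary times a positive contraction `h`, and `h` is the mean of the
unitaries `h ± i √(1 - h²)`. -/
theorem exists_unitary_add_eq {B : Type*} [CStarAlgebra B] (U : unitary B) {y : B}
    (hy : ‖y‖ < 1) : ∃ U₁ U₂ : unitary B, (U : B) + y = U₁ + U₂ := by
  obtain _ | _ := subsingleton_or_nontrivial B
  · exact ⟨1, 1, Subsingleton.elim _ _⟩
  let _ := CStarAlgebra.spectralOrder B
  let _ := CStarAlgebra.spectralOrderedRing B
  set x : B := (2⁻¹ : ℂ) • ((U : B) + y) with hx
  have hxn : ‖x‖ ≤ 1 := by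
    rw [hx, norm_smul]
    have h1 : ‖(U : B)‖ = 1 := CStarRing.norm_of_mem_unitary U.2
    have := norm_add_le (U : B) y
    norm_num
    linarith
  have hxu : IsUnit x := by
    have h1 : IsUnit (1 + star (U : B) * y) := by
      have : ‖-(star (U : B) * y)‖ < 1 := by
        rwa [norm_neg, CStarRing.norm_mem_unitary_mul y (Unitary.star_mem U.2)]
      simpa using isUnit_one_sub_of_norm_lt_one this
    have h2 : (U : B) + y = U * (1 + star (U : B) * y) := by
      simp [mul_add, ← mul_assoc]
    have h3 : IsUnit (U : B) := (Unitary.toUnits U).isUnit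
    rw [hx, h2]
    exact (h3.mul h1).smul (Units.mk0 (2⁻¹ : ℂ) (by norm_num))
  -- polar decomposition `x = w * h` of the invertible contraction `x`
  set h : B := CFC.sqrt (star x * x) with hh
  have hsa : IsSelfAdjoint h := (CFC.sqrt_nonneg _).isSelfAdjoint
  have hsq : h * h = star x * x := CFC.sqrt_mul_sqrt_self _ (star_mul_self_nonneg x)
  have hu : IsUnit h := by
    have h4 : IsUnit (h ^ 2) := by rw [sq, hsq]; exact hxu.star.mul hxu
    exact (isUnit_pow_iff two_ne_zero).1 h4
  have hn : ‖h‖ ≤ 1 := by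
    have h5 : ‖h‖ * ‖h‖ = ‖x‖ * ‖x‖ := by
      rw [← CStarRing.norm_star_mul_self (x := x), ← hsq, ← CStarRing.norm_star_mul_self (x := h),
        hsa.star_eq]
    nlinarith [norm_nonneg h, norm_nonneg x]
  obtain ⟨g, hg⟩ := hu
  have hgs : star ((g⁻¹ : Bˣ) : B) = ((g⁻¹ : Bˣ) : B) := by
    have : star g = g := Units.ext (by rw [Units.coe_star, hg, hsa.star_eq])
    rw [← Units.coe_star, star_inv, this]
  have hw : x * ((g⁻¹ : Bˣ) : B) ∈ unitary B := by
    refine (hxu.mul g⁻¹.isUnit).mem_unitary_of_star_mul_self ?_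
    rw [star_mul, hgs, mul_assoc, ← mul_assoc (star x), ← hsq, ← hg]
    simp
  let s := selfAdjoint.unitarySelfAddISMul ⟨h, hsa⟩ hn
  have hs : (s : B) + star (s : B) = (2 : ℂ) • h := by
    have h6 : star (s : B) = h - Complex.I • CFC.sqrt (1 - h ^ 2) :=
      selfAdjoint.star_coe_unitarySelfAddISMul ⟨h, hsa⟩ hn
    have h7 : (s : B) = h + Complex.I • CFC.sqrt (1 - h ^ 2) := rfl
    rw [h6, h7, two_smul]
    abel
  refine ⟨⟨_, hw⟩ * s, ⟨_, hw⟩ * star s, ?_⟩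
  have : (U : B) + y = (2 : ℂ) • x := by rw [hx, smul_smul]; norm_num
  rw [this]
  simp only [Submonoid.coe_mul, Unitary.coe_star]
  rw [← mul_add, hs, mul_smul_comm, mul_assoc, ← hg]
  simp

/-- The Russo–Dye theorem in dual form: a real functional that is at most `m` on the unitary group
is at most `m` on the closed unit ball. -/
theorem le_of_forall_unitary_le {B : Type*} [CStarAlgebra B] (ψ : B →L[ℝ] ℝ) {m : ℝ}
    (hm : ∀ U : unitary B, ψ U ≤ m) {y : B} (hy : ‖y‖ ≤ 1) : ψ y ≤ m := by
  have key : ∀ y : B, ‖y‖ < 1 → ψ y ≤ m := by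
    intro y hy
    set S : Set ℝ := Set.range fun U : unitary B => ψ U
    have hb : BddAbove S := ⟨m, by rintro _ ⟨U, rfl⟩; exact hm U⟩
    have hS : sSup S ≤ m := csSup_le (Set.range_nonempty _) (by rintro _ ⟨U, rfl⟩; exact hm U)
    -- `ψ U = ψ U₁ + ψ U₂ - ψ y` for every unitary `U`; take the supremum over `U`
    have h1 : sSup S ≤ 2 * sSup S - ψ y := by
      refine csSup_le (Set.range_nonempty _) ?_
      rintro _ ⟨U, rfl⟩
      obtain ⟨U₁, U₂, h⟩ := exists_unitary_add_eq U hy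
      have h2 := congrArg ψ h
      rw [map_add, map_add] at h2
      have h3 := le_csSup hb ⟨U₁, rfl⟩
      have h4 := le_csSup hb ⟨U₂, rfl⟩
      simp only at h3 h4 ⊢
      linarith
    linarith
  have ht : Tendsto (fun t : ℝ => ψ (t • y)) (𝓝[<] 1) (𝓝 (ψ y)) := by
    have : Continuous fun t : ℝ => ψ (t • y) := by fun_prop
    simpa using (this.tendsto 1).mono_left nhdsWithin_le_nhds
  refine le_of_tendsto ht ?_
  filter_upwards [Ioo_mem_nhdsLT (show (0 : ℝ) < 1 by norm_num)] with t ht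
  refine key _ ?_
  rw [norm_smul, Real.norm_of_nonneg ht.1.le]
  nlinarith [ht.1, ht.2, norm_nonneg y]

/-! ### Density of the unitary group of `𝒜` in that of `𝒜''` -/

section Density

variable {H : Type*} [NormedAddCommGroup H] [InnerProductSpace ℂ H] [CompleteSpace H]

/-- The diagonal action of an operator on a finite power of `H`, with the Hilbert space norm. -/
noncomputable def amplify (ι : Type*) [Fintype ι] (x : H →L[ℂ] H) :
    PiLp 2 (fun _ : ι => H) →L[ℂ] PiLp 2 (fun _ : ι => H) :=
  (PiLp.continuousLinearEquiv 2 ℂ (fun _ : ι => H)).symm.toContinuousLinearMap ∘L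
    ContinuousLinearMap.piMap (fun _ => x) ∘L
      (PiLp.continuousLinearEquiv 2 ℂ (fun _ : ι => H)).toContinuousLinearMap

omit [CompleteSpace H] in
@[simp]
theorem amplify_apply {ι : Type*} [Fintype ι] (x : H →L[ℂ] H) (w : PiLp 2 (fun _ : ι => H))
    (i : ι) : amplify ι x w i = x (w i) := rfl

theorem inner_amplify {ι : Type*} [Fintype ι] (x : H →L[ℂ] H) (v w : PiLp 2 (fun _ : ι => H)) :
    ⟪v, amplify ι x w⟫_ℂ = ⟪amplify ι (star x) v, w⟫_ℂ := by
  simp [PiLp.inner_apply, ContinuousLinearMap.star_eq_adjoint,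
    ContinuousLinearMap.adjoint_inner_left]

/-- The double commutant theorem in dual form: a weakly continuous functional that vanishes on `𝒜`
vanishes on `𝒜''`. The vector `T ξ` lies in the closure of `𝒜 ξ` inside a finite power of `H`,
because the projection onto that closure commutes with the diagonal action of `𝒜`. -/
theorem inner_eq_zero_of_mem_bicommutant {ι : Type*} [Fintype ι]
    (𝒜 : StarSubalgebra ℂ (H →L[ℂ] H)) (ζ ξ : ι → H)
    (h : ∀ x ∈ 𝒜, ∑ j, ⟪ζ j, x (ξ j)⟫_ℂ = 0) {T : H →L[ℂ] H}
    (hT : T ∈ CARAlg.bicommutant (𝒜 : Set (H →L[ℂ] H))) : ∑ j, ⟪ζ j, T (ξ j)⟫_ℂ = 0 := by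
  classical
  let ξ' : PiLp 2 (fun _ : ι => H) := WithLp.toLp 2 ξ
  let ζ' : PiLp 2 (fun _ : ι => H) := WithLp.toLp 2 ζ
  let S : Submodule ℂ (PiLp 2 (fun _ : ι => H)) :=
    { carrier := {w | ∃ x ∈ 𝒜, amplify ι x ξ' = w}
      add_mem' := by
        rintro _ _ ⟨x, hx, rfl⟩ ⟨y, hy, rfl⟩
        exact ⟨x + y, add_mem hx hy, by ext i; simp⟩
      zero_mem' := ⟨0, zero_mem _, by ext i; simp⟩
      smul_mem' := by
        rintro c _ ⟨x, hx, rfl⟩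
        exact ⟨c • x, SMulMemClass.smul_mem c hx, by ext i; simp⟩ }
  let M := S.topologicalClosure
  have : CompleteSpace M := S.isClosed_topologicalClosure.completeSpace_coe
  let P := M.starProjection
  have hinv : ∀ x ∈ 𝒜, ∀ w ∈ M, amplify ι x w ∈ M := by
    intro x hx w hw
    refine map_mem_closure (amplify ι x).continuous hw ?_
    rintro _ ⟨y, hy, rfl⟩
    exact ⟨x * y, mul_mem hx hy, by ext i; simp⟩
  have hcomm : ∀ x ∈ 𝒜, ∀ w, P (amplify ι x w) = amplify ι x (P w) := by
    intro x hx w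
    refine Submodule.eq_starProjection_of_mem_orthogonal
      (hinv x hx _ (Submodule.starProjection_apply_mem _ _)) ?_
    rw [← map_sub, Submodule.mem_orthogonal]
    intro u hu
    rw [inner_amplify]
    exact (Submodule.mem_orthogonal _ _).1 (Submodule.sub_starProjection_mem_orthogonal w) _
      (hinv _ (star_mem hx) u hu)
  let inj (j : ι) : H →L[ℂ] PiLp 2 (fun _ : ι => H) :=
    (PiLp.continuousLinearEquiv 2 ℂ (fun _ : ι => H)).symm.toContinuousLinearMap ∘L
      ContinuousLinearMap.single ℂ (fun _ : ι => H) j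
  have hinj (j i : ι) (v : H) : inj j v i = Pi.single (M := fun _ => H) j v i := rfl
  have hsum (w : PiLp 2 (fun _ : ι => H)) : ∑ j, inj j (w j) = w := by
    ext i
    simp [hinj, Pi.single_apply]
  have hamp (x : H →L[ℂ] H) (j : ι) (v : H) : amplify ι x (inj j v) = inj j (x v) := by
    ext i
    by_cases hij : i = j
    · subst hij; simp [hinj]
    · simp [hinj, hij]
  -- the matrix entries of `P` lie in the commutant of `𝒜`, hence commute with `T`
  let Q (i j : ι) : H →L[ℂ] H := PiLp.proj 2 (fun _ : ι => H) i ∘L P ∘L inj j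
  have hQ (i j : ι) : Q i j ∈ Set.centralizer (𝒜 : Set (H →L[ℂ] H)) := by
    intro x hx
    ext v
    change x (P (inj j v) i) = P (inj j (x v)) i
    rw [← hamp, hcomm x hx]
    rfl
  have hQT (i j : ι) (v : H) : T (P (inj j v) i) = P (inj j (T v)) i :=
    (DFunLike.congr_fun (hT _ (hQ i j)) v).symm
  have hPT (w : PiLp 2 (fun _ : ι => H)) : P (amplify ι T w) = amplify ι T (P w) := by
    ext i
    conv_lhs => rw [← hsum w]
    conv_rhs => rw [← hsum w]
    simp [map_sum, hamp, hQT]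
  have hξ : ξ' ∈ M := subset_closure ⟨1, one_mem _, by ext i; simp⟩
  have hTξ : amplify ι T ξ' ∈ M := by
    have : amplify ι T ξ' = P (amplify ι T ξ') := by
      rw [hPT, Submodule.starProjection_eq_self_iff.2 hξ]
    rw [this]
    exact Submodule.starProjection_apply_mem _ _
  have hζ : ζ' ∈ Mᗮ := by
    rw [Submodule.orthogonal_closure, Submodule.mem_orthogonal']
    rintro _ ⟨x, hx, rfl⟩
    simpa [PiLp.inner_apply, ζ', ξ'] using h x hx
  simpa [PiLp.inner_apply, ζ', ξ'] using (Submodule.mem_orthogonal' _ _).1 hζ _ hTξ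

/-- The `*`-strong density of `𝒜` in `𝒜''`. As taking adjoints is only antilinear, the closure of
`{(x ξ, x⋆ η) | x ∈ 𝒜}` is treated as a real subspace; a real functional that vanishes on it is the
real part of a complex functional `x ↦ ∑ ⟪ζ j, x (ξ j)⟫ + ∑ ⟪η j, x (ζ' j)⟫` of `x`. -/
theorem exists_mem_approx_of_mem_bicommutant {ι : Type*} [Fintype ι]
    (𝒜 : StarSubalgebra ℂ (H →L[ℂ] H)) (ξ η : ι → H) {T : H →L[ℂ] H}
    (hT : T ∈ CARAlg.bicommutant (𝒜 : Set (H →L[ℂ] H))) {δ : ℝ} (hδ : 0 < δ) :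
    ∃ k ∈ 𝒜, ∀ j, ‖k (ξ j) - T (ξ j)‖ < δ ∧ ‖star k (η j) - star T (η j)‖ < δ := by
  let _ : InnerProductSpace ℝ H := InnerProductSpace.complexToReal
  let F (x : H →L[ℂ] H) : PiLp 2 (fun _ : ι ⊕ ι => H) :=
    WithLp.toLp 2 (Sum.elim (fun j => x (ξ j)) fun j => star x (η j))
  let S : Submodule ℝ (PiLp 2 (fun _ : ι ⊕ ι => H)) :=
    { carrier := {w | ∃ x ∈ 𝒜, F x = w}
      add_mem' := by
        rintro _ _ ⟨x, hx, rfl⟩ ⟨y, hy, rfl⟩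
        exact ⟨x + y, add_mem hx hy, by ext i; rcases i with i | i <;> simp [F]⟩
      zero_mem' := ⟨0, zero_mem _, by ext i; rcases i with i | i <;> simp [F]⟩
      smul_mem' := by
        rintro c _ ⟨x, hx, rfl⟩
        refine ⟨(c : ℂ) • x, SMulMemClass.smul_mem _ hx, ?_⟩
        ext i; rcases i with i | i <;> simp [F] }
  have hre (w : PiLp 2 (fun _ : ι ⊕ ι => H)) (x : H →L[ℂ] H) : ⟪w, F x⟫_ℝ =
      (∑ j, ⟪Sum.elim (fun i => w (.inl i)) η j, x (Sum.elim ξ (fun i => w (.inr i)) j)⟫_ℂ).re := by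
    have h1 (u v : H) : ⟪u, star x v⟫_ℝ = ⟪v, x u⟫_ℝ := by
      change (⟪u, star x v⟫_ℂ).re = (⟪v, x u⟫_ℂ).re
      rw [ContinuousLinearMap.star_eq_adjoint, ContinuousLinearMap.adjoint_inner_right,
        ← inner_conj_symm, Complex.conj_re]
    rw [PiLp.inner_apply, Fintype.sum_sum_type, Fintype.sum_sum_type, Complex.add_re,
      Complex.re_sum, Complex.re_sum]
    simp only [F, Sum.elim_inl, Sum.elim_inr, h1]
    rfl
  have hmem : F T ∈ Sᗮᗮ := by
    rw [Submodule.mem_orthogonal]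
    intro w hw
    have hz : ∀ x ∈ 𝒜, (∑ j, ⟪Sum.elim (fun i => w (.inl i)) η j,
        x (Sum.elim ξ (fun i => w (.inr i)) j)⟫_ℂ).re = 0 := by
      intro x hx
      rw [← hre]
      exact (Submodule.mem_orthogonal' _ _).1 hw _ ⟨x, hx, rfl⟩
    rw [hre, inner_eq_zero_of_mem_bicommutant 𝒜 _ _ _ hT, Complex.zero_re]
    intro x hx
    -- the imaginary part vanishes as well: replace `x` by `-i x`
    refine Complex.ext (hz x hx) ?_
    have := hz ((-Complex.I) • x) (SMulMemClass.smul_mem _ hx)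
    simp only [smul_apply, inner_smul_right, ← Finset.mul_sum] at this
    simpa using this
  rw [Submodule.orthogonal_orthogonal_eq_closure] at hmem
  obtain ⟨_, ⟨k, hk, rfl⟩, hkd⟩ := Metric.mem_closure_iff.1 hmem δ hδ
  rw [dist_comm, dist_eq_norm] at hkd
  have hc (i) : ‖(F k - F T) i‖ < δ := (PiLp.norm_apply_le _ i).trans_lt hkd
  exact ⟨k, hk, fun j => ⟨hc (.inl j), hc (.inr j)⟩⟩

theorem isUnit_one_add_star_mul_self {B : Type*} [CStarAlgebra B] (k : B) :
    IsUnit (1 + star k * k) := by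
  let _ := CStarAlgebra.spectralOrder B
  let _ := CStarAlgebra.spectralOrderedRing B
  exact CStarAlgebra.isUnit_of_le (1 : B) (le_add_of_nonneg_right (star_mul_self_nonneg k))

/-- The contraction is `c = 2 k (1 + k⋆ k)⁻¹`. The map `k ↦ c` fixes unitaries and is continuous at
them for the `*`-strong topology, without any bound on `‖k‖`. -/
theorem exists_contraction
    (𝒜 : StarSubalgebra ℂ (H →L[ℂ] H)) (hcl : IsClosed (𝒜 : Set (H →L[ℂ] H)))
    {k : H →L[ℂ] H} (hk : k ∈ 𝒜) : ∃ c ∈ 𝒜, ‖c‖ ≤ 1 ∧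
      ∀ (V : H →L[ℂ] H) (ξ : H), ‖c ξ - V ξ‖ ≤ 2 * ‖k ξ - V ξ‖ + ‖star k (V ξ) - ξ‖ := by
  obtain ⟨R, hR, hR1, hR2⟩ : ∃ R ∈ 𝒜, R * (1 + star k * k) = 1 ∧ (1 + star k * k) * R = 1 := by
    have : IsClosed (𝒜 : Set (H →L[ℂ] H)) := hcl
    let k' : 𝒜 := ⟨k, hk⟩
    have hu : IsUnit (1 + star k' * k') := isUnit_one_add_star_mul_self k'
    obtain ⟨g, hg⟩ := hu
    refine ⟨((g⁻¹ : 𝒜ˣ) : 𝒜), Subtype.prop _, ?_, ?_⟩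
    · have := congrArg (Subtype.val : 𝒜 → _) (g.inv_mul)
      rw [hg] at this
      exact this
    · have := congrArg (Subtype.val : 𝒜 → _) (g.mul_inv)
      rw [hg] at this
      exact this
  -- for `y = R η` the identity `η = y + k⋆ k y` gives `‖2 k R‖ ≤ 1` and `‖k R k⋆‖ ≤ 1`
  have hadj (u v : H) : ⟪u, star k v⟫_ℂ = ⟪k u, v⟫_ℂ := by
    rw [ContinuousLinearMap.star_eq_adjoint, ContinuousLinearMap.adjoint_inner_right]
  have hRy (η : H) : R η + star k (k (R η)) = η := DFunLike.congr_fun hR2 η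
  have hb1 (η : H) : 2 * ‖k (R η)‖ ≤ ‖η‖ := by
    set y := R η with hy
    have h1 : ‖k y‖ ^ 2 ≤ ‖y‖ * ‖star k (k y)‖ := by
      have h2 : ⟪y, star k (k y)⟫_ℂ = (‖k y‖ : ℂ) ^ 2 := by
        rw [hadj, inner_self_eq_norm_sq_to_K]; rfl
      have h3 := norm_inner_le_norm (𝕜 := ℂ) y (star k (k y))
      rw [h2] at h3
      simpa using h3
    have h4 : ‖η‖ ^ 2 = ‖y‖ ^ 2 + 2 * ‖k y‖ ^ 2 + ‖star k (k y)‖ ^ 2 := by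
      conv_lhs => rw [← hRy η, ← hy, @norm_add_sq ℂ, hadj, inner_self_eq_norm_sq_to_K]
      norm_cast
    have h5 : (2 * ‖k y‖) ^ 2 ≤ ‖η‖ ^ 2 := by
      nlinarith [sq_nonneg (‖y‖ - ‖star k (k y)‖)]
    exact (pow_le_pow_iff_left₀ (by positivity) (norm_nonneg _) two_ne_zero).1 h5
  have hb2 (η : H) : ‖k (R (star k η))‖ ≤ ‖η‖ := by
    set y := R (star k η) with hy
    have h1 : ‖y‖ ^ 2 + ‖k y‖ ^ 2 ≤ ‖k y‖ * ‖η‖ := by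
      have h2 : ⟪y, star k η⟫_ℂ = ((‖y‖ ^ 2 + ‖k y‖ ^ 2 : ℝ) : ℂ) := by
        conv_lhs => rw [← hRy (star k η), ← hy, inner_add_right, hadj, inner_self_eq_norm_sq_to_K,
          inner_self_eq_norm_sq_to_K]
        norm_cast
      have h3 := norm_inner_le_norm (𝕜 := ℂ) (k y) η
      rw [← hadj, h2, Complex.norm_real, Real.norm_of_nonneg (by positivity)] at h3
      exact h3
    by_contra! h
    nlinarith [sq_nonneg ‖y‖, norm_nonneg η]
  refine ⟨(2 : ℂ) • (k * R), SMulMemClass.smul_mem _ (mul_mem hk hR), ?_, fun V ξ => ?_⟩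
  · refine ContinuousLinearMap.opNorm_le_bound _ zero_le_one fun η => ?_
    have := hb1 η
    simpa [norm_smul] using this
  · have h1 : R ξ + R (star k (k ξ)) = ξ := by
      have := DFunLike.congr_fun hR1 ξ
      simpa [mul_add] using this
    have h2 : (2 : ℂ) • k (R ξ) - V ξ = -k (R (star k (V ξ) - ξ)) - k (R (star k (k ξ - V ξ)))
        + (k ξ - V ξ) := by
      have h3 : k ξ = k (R ξ) + k (R (star k (k ξ))) := by rw [← map_add, h1]
      simp only [map_sub]
      linear_combination (norm := module) -h3
    change ‖(2 : ℂ) • k (R ξ) - V ξ‖ ≤ _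
    rw [h2]
    have h4 := hb1 (star k (V ξ) - ξ)
    have h5 := hb2 (k ξ - V ξ)
    have h6 := norm_add_le (-k (R (star k (V ξ) - ξ)) - k (R (star k (k ξ - V ξ)))) (k ξ - V ξ)
    have h7 := norm_sub_le (-k (R (star k (V ξ) - ξ))) (k (R (star k (k ξ - V ξ))))
    rw [norm_neg] at h7
    linarith [norm_nonneg (star k (V ξ) - ξ)]

/-- Kaplansky's density theorem for unitaries. Some contraction `c ∈ 𝒜` is close to `V` on the given
vectors. As `c` is approximated by means of unitaries of `𝒜` and `V (ξ j)` is as long as `ξ j`, one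
of these unitaries has to be close to `V` on them, too. -/
theorem exists_unitary_approx_of_mem_bicommutant {ι : Type*} [Fintype ι]
    (𝒜 : StarSubalgebra ℂ (H →L[ℂ] H)) (hcl : IsClosed (𝒜 : Set (H →L[ℂ] H)))
    (V : unitary (H →L[ℂ] H)) (hV : (V : H →L[ℂ] H) ∈ CARAlg.bicommutant (𝒜 : Set (H →L[ℂ] H)))
    (ξ : ι → H) {ε : ℝ} (hε : 0 < ε) :
    ∃ U : unitary (H →L[ℂ] H), (U : H →L[ℂ] H) ∈ 𝒜 ∧
      ∀ j, ‖(U : H →L[ℂ] H) (ξ j) - (V : H →L[ℂ] H) (ξ j)‖ < ε := by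
  have : IsClosed (𝒜 : Set (H →L[ℂ] H)) := hcl
  have hVn (v : H) : ‖(V : H →L[ℂ] H) v‖ = ‖v‖ := Unitary.norm_map V v
  set v : ι → H := fun j => (V : H →L[ℂ] H) (ξ j) with hv
  let ψ : 𝒜 →L[ℝ] ℝ := ∑ j, Complex.reCLM ∘L
    ((innerSL ℂ (v j) ∘L ContinuousLinearMap.apply ℂ H (ξ j)).restrictScalars ℝ ∘L
      (𝒜.toSubalgebra.toSubmodule.subtypeL).restrictScalars ℝ)
  have hψ (x : 𝒜) : ψ x = ∑ j, (⟪v j, (x : H →L[ℂ] H) (ξ j)⟫_ℂ).re := by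
    simp [ψ]
    rfl
  by_contra! hcon
  set s : ℝ := ∑ j, ‖ξ j‖ ^ 2 with hs
  -- `ψ U = s - ∑ ‖U (ξ j) - V (ξ j)‖² / 2` for a unitary `U`
  have hm : ∀ U : unitary 𝒜, ψ U ≤ s - ε ^ 2 / 2 := by
    intro U
    have hU : ((U : 𝒜) : H →L[ℂ] H) ∈ unitary (H →L[ℂ] H) :=
      Unitary.map_mem 𝒜.subtype U.2
    obtain ⟨j, hj⟩ := hcon ⟨_, hU⟩ (U : 𝒜).2
    have hre (i : ι) : (⟪v i, ((U : 𝒜) : H →L[ℂ] H) (ξ i)⟫_ℂ).re =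
        ‖ξ i‖ ^ 2 - ‖((U : 𝒜) : H →L[ℂ] H) (ξ i) - v i‖ ^ 2 / 2 := by
      have h1 := @norm_sub_sq ℂ _ _ _ _ (((U : 𝒜) : H →L[ℂ] H) (ξ i)) (v i)
      have h2 : ‖((U : 𝒜) : H →L[ℂ] H) (ξ i)‖ = ‖ξ i‖ := Unitary.norm_map ⟨_, hU⟩ (ξ i)
      rw [h2, hVn, ← inner_re_symm] at h1
      change _ = _ - 2 * (⟪v i, ((U : 𝒜) : H →L[ℂ] H) (ξ i)⟫_ℂ).re + _ at h1
      linarith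
    rw [hψ, Finset.sum_congr rfl fun i _ => hre i, Finset.sum_sub_distrib, ← Finset.sum_div]
    have h3 := Finset.single_le_sum
      (f := fun i => ‖((U : 𝒜) : H →L[ℂ] H) (ξ i) - v i‖ ^ 2) (fun i _ => sq_nonneg _)
      (Finset.mem_univ j)
    have h4 : ε ^ 2 ≤ ‖((U : 𝒜) : H →L[ℂ] H) (ξ j) - v j‖ ^ 2 := pow_le_pow_left₀ hε.le hj 2
    linarith
  set S : ℝ := ∑ j, ‖ξ j‖ with hS
  have hS0 : 0 ≤ S := Finset.sum_nonneg fun _ _ => norm_nonneg _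
  set δ : ℝ := ε ^ 2 / (6 * (S + 1)) with hδ
  have hδ0 : 0 < δ := by positivity
  obtain ⟨k, hk, hkd⟩ := exists_mem_approx_of_mem_bicommutant 𝒜 ξ v hV hδ0
  obtain ⟨c, hc, hc1, hcV⟩ := exists_contraction 𝒜 hcl hk
  have hcm : ψ ⟨c, hc⟩ ≤ s - ε ^ 2 / 2 := le_of_forall_unitary_le ψ hm hc1
  have hlow : s - 3 * δ * S ≤ ψ ⟨c, hc⟩ := by
    rw [hψ, hs, hS, Finset.mul_sum, ← Finset.sum_sub_distrib]
    refine Finset.sum_le_sum fun j _ => ?_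
    have h1 : ‖c (ξ j) - v j‖ ≤ 3 * δ := by
      have h2 := hcV V (ξ j)
      have h3 : star (V : H →L[ℂ] H) (v j) = ξ j := by
        have := DFunLike.congr_fun (Unitary.coe_star_mul_self V) (ξ j)
        exact this
      have h4 := (hkd j).2
      rw [h3] at h4
      have h5 := (hkd j).1
      linarith
    have h2 : (⟪v j, c (ξ j)⟫_ℂ).re = ‖ξ j‖ ^ 2 + (⟪v j, c (ξ j) - v j⟫_ℂ).re := by
      have h6 : (⟪v j, v j⟫_ℂ).re = ‖ξ j‖ ^ 2 := by
        rw [← hVn (ξ j)]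
        exact inner_self_eq_norm_sq (𝕜 := ℂ) (v j)
      rw [inner_sub_right, Complex.sub_re, h6]
      ring
    have h3 : |(⟪v j, c (ξ j) - v j⟫_ℂ).re| ≤ ‖ξ j‖ * (3 * δ) :=
      ((Complex.abs_re_le_norm _).trans (norm_inner_le_norm _ _)).trans (by rw [hVn]; gcongr)
    have h4 := (abs_le.1 h3).1
    simp only [h2]
    linarith
  have h1 : δ * (6 * (S + 1)) = ε ^ 2 := div_mul_cancel₀ _ (by positivity)
  nlinarith

end Density

/-! ### Weakly null unitaries in a non-atomic von Neumann algebra -/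

section Nonatomic

variable {H : Type*} [NormedAddCommGroup H] [InnerProductSpace ℂ H] [CompleteSpace H]

/-- The sum of the squared moduli of the matrix coefficients of `u` at a finite family `f` of
vectors. -/
noncomputable def matrixCoeffSq {ι : Type*} [Fintype ι] (f : ι → H) (u : H →L[ℂ] H) : ℝ :=
  ∑ i, ∑ j, ‖⟪f i, u (f j)⟫_ℂ‖ ^ 2

/-- For a projection `e` this is the value of the positive functional `x ↦ ∑ ⟪f i, x (f i)⟫`
at `e`. -/
noncomputable def massOn {ι : Type*} [Fintype ι] (f : ι → H) (e : H →L[ℂ] H) : ℝ :=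
  ∑ i, ‖e (f i)‖ ^ 2

omit [CompleteSpace H] in
theorem matrixCoeffSq_add_add_matrixCoeffSq_sub {ι : Type*} [Fintype ι] (f : ι → H)
    (u v : H →L[ℂ] H) : matrixCoeffSq f (u + v) + matrixCoeffSq f (u - v) =
      2 * (matrixCoeffSq f u + matrixCoeffSq f v) := by
  simp only [matrixCoeffSq, ← Finset.sum_add_distrib, Finset.mul_sum]
  refine Finset.sum_congr rfl fun i _ => Finset.sum_congr rfl fun j _ => ?_
  simp only [add_apply, sub_apply, inner_add_right, inner_sub_right]
  have := parallelogram_law_with_norm ℂ ⟪f i, u (f j)⟫_ℂ ⟪f i, v (f j)⟫_ℂ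
  simp only [sq]
  linarith

theorem IsStarProjection.inner_apply_apply {e : H →L[ℂ] H} (he : IsStarProjection e) (v w : H) :
    ⟪v, e w⟫_ℂ = ⟪e v, e w⟫_ℂ := by
  conv_lhs => rw [← he.isIdempotentElem.eq]
  rw [mul_apply_eq_comp]
  have := he.isSelfAdjoint.star_eq
  conv_lhs => rw [← this]
  rw [ContinuousLinearMap.star_eq_adjoint, ContinuousLinearMap.adjoint_inner_right,
    ← ContinuousLinearMap.star_eq_adjoint, this]

theorem matrixCoeffSq_le_massOn_sq {ι : Type*} [Fintype ι] (f : ι → H) {e : H →L[ℂ] H}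
    (he : IsStarProjection e) : matrixCoeffSq f e ≤ massOn f e ^ 2 := by
  rw [sq, massOn, Finset.sum_mul_sum, matrixCoeffSq]
  refine Finset.sum_le_sum fun i _ => Finset.sum_le_sum fun j _ => ?_
  rw [he.inner_apply_apply, ← mul_pow]
  exact pow_le_pow_left₀ (norm_nonneg _) (norm_inner_le_norm _ _) 2

theorem massOn_add {ι : Type*} [Fintype ι] (f : ι → H) {e p : H →L[ℂ] H}
    (he : IsStarProjection e) (hep : e * p = 0) :
    massOn f (e + p) = massOn f e + massOn f p := by
  simp only [massOn, ← Finset.sum_add_distrib]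
  refine Finset.sum_congr rfl fun i _ => ?_
  have h : ⟪e (f i), p (f i)⟫_ℂ = 0 := by
    have h1 : ⟪e (f i), p (f i)⟫_ℂ = ⟪f i, (e * p) (f i)⟫_ℂ := by
      have := he.isSelfAdjoint.star_eq
      rw [mul_apply_eq_comp]
      conv_lhs => rw [← this]
      rw [ContinuousLinearMap.star_eq_adjoint, ContinuousLinearMap.adjoint_inner_left]
    rw [h1, hep]; simp
  have := norm_add_sq_eq_norm_sq_add_norm_sq_of_inner_eq_zero _ _ h
  simp only [add_apply, sq]
  linarith

/-- There is a self-adjoint `u ∈ N` with `u² = e` whose matrix coefficients at the vectors `f` are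
small in comparison with the mass of `e`. -/
def HasSmallSymmetry {ι : Type*} [Fintype ι] (N : VonNeumannAlgebra H) (f : ι → H) (ε : ℝ)
    (e : H →L[ℂ] H) : Prop :=
  ∃ u ∈ N, IsSelfAdjoint u ∧ u * u = e ∧ matrixCoeffSq f u ≤ ε * massOn f e

theorem HasSmallSymmetry.of_massOn_le {ι : Type*} [Fintype ι] {N : VonNeumannAlgebra H}
    {f : ι → H} {ε : ℝ} {e : H →L[ℂ] H} (heN : e ∈ N) (he : IsStarProjection e)
    (h : massOn f e ≤ ε) : HasSmallSymmetry N f ε e := by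
  refine ⟨e, heN, he.isSelfAdjoint, he.isIdempotentElem, ?_⟩
  have h0 : 0 ≤ massOn f e := Finset.sum_nonneg fun _ _ => sq_nonneg _
  have := matrixCoeffSq_le_massOn_sq f he
  nlinarith

/-- By the parallelogram law the mean of the quantities `matrixCoeffSq f (u ± v)` is the sum of
those of `u` and `v`, so one of the two signs is good enough. -/
theorem HasSmallSymmetry.add {ι : Type*} [Fintype ι] {N : VonNeumannAlgebra H}
    {f : ι → H} {ε : ℝ} {e p : H →L[ℂ] H} (he : IsStarProjection e)
    (hep : e * p = 0) (h₁ : HasSmallSymmetry N f ε e) (h₂ : HasSmallSymmetry N f ε p) :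
    HasSmallSymmetry N f ε (e + p) := by
  obtain ⟨u, huN, hu, hue, hu'⟩ := h₁
  obtain ⟨v, hvN, hv, hvp, hv'⟩ := h₂
  have huv : u * v = 0 := by
    -- `‖e v‖² = ‖e v v e‖ = ‖e p e‖ = 0` and `‖u v‖² = ‖v u u v‖ = ‖v e v‖ = 0`
    have h1 : e * v = 0 := by
      rw [← CStarRing.mul_star_self_eq_zero_iff, star_mul, hv.star_eq, mul_assoc,
        ← mul_assoc v, hvp, ← mul_assoc, hep, zero_mul]
    rw [← CStarRing.star_mul_self_eq_zero_iff, star_mul, hu.star_eq, mul_assoc,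
        ← mul_assoc u, hue, h1, mul_zero]
  have hvu : v * u = 0 := by
    simpa [hu.star_eq, hv.star_eq] using congrArg star huv
  have hsum := matrixCoeffSq_add_add_matrixCoeffSq_sub f u v
  have hmass := massOn_add f he hep
  by_cases hle : matrixCoeffSq f (u + v) ≤ ε * massOn f (e + p)
  · exact ⟨u + v, add_mem huN hvN, hu.add hv,
      by rw [mul_add, add_mul, add_mul, huv, hvu, hue, hvp]; simp, hle⟩
  · refine ⟨u - v, sub_mem huN hvN, hu.sub hv,
      by rw [mul_sub, sub_mul, sub_mul, huv, hvu, hue, hvp]; simp, ?_⟩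
    rw [hmass] at hle ⊢
    nlinarith

/-- A chain of projections of `N` has a lower bound in `N` that is a strong limit of members of the
chain. The kernels of the projections increase along the chain, and the bound is the projection
with kernel the closure of their union. -/
theorem exists_inf_of_isChain (N : VonNeumannAlgebra H)
    {c : Set (H →L[ℂ] H)} (hcne : c.Nonempty) (hc : ∀ e ∈ c, e ∈ N ∧ IsStarProjection e)
    (hchain : IsChain (fun e p => e * p = p) c) :
    ∃ p ∈ N, IsStarProjection p ∧ (∀ e ∈ c, e * p = p) ∧
      ∃ l : Filter (H →L[ℂ] H), l.NeBot ∧ (∀ᶠ e in l, e ∈ c) ∧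
        ∀ x, Tendsto (fun e : H →L[ℂ] H => e x) l (𝓝 (p x)) := by
  have hsa (e : c) : star (e : H →L[ℂ] H) = e := (hc e e.2).2.isSelfAdjoint.star_eq
  have hidem (e : c) : (e : H →L[ℂ] H) * e = e := (hc e e.2).2.isIdempotentElem.eq
  -- the reverse of the order of projections, for which `atTop` runs down the chain
  let P : Preorder c :=
    { le := fun e p => (e : H →L[ℂ] H) * p = p
      lt := fun e p => (e : H →L[ℂ] H) * p = p ∧ ¬ (p : H →L[ℂ] H) * e = e
      lt_iff_le_not_ge := fun _ _ => Iff.rfl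
      le_refl := hidem
      le_trans := fun e p q (h₁ : (e : H →L[ℂ] H) * p = p) (h₂ : (p : H →L[ℂ] H) * q = q) => by
        rw [← h₂, ← mul_assoc, h₁] }
  let _ : LE c := P.toLE
  have hle (e p : c) : e ≤ p ↔ (e : H →L[ℂ] H) * p = p := Iff.rfl
  have : Nonempty c := hcne.to_subtype
  have : IsDirectedOrder c := ⟨fun e p => by
    by_cases h : (e : H →L[ℂ] H) = p
    · exact ⟨e, le_rfl, by rw [Subtype.ext h]⟩
    · rcases hchain e.2 p.2 h with h | h
      · exact ⟨p, h, le_rfl⟩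
      · exact ⟨e, le_rfl, h⟩⟩
  let U (e : c) : Submodule ℂ H := (e : H →L[ℂ] H).ker
  have hUm : Monotone U := by
    intro e p hep x hx
    have h : (p : H →L[ℂ] H) * e = p := by
      have := congrArg star ((hle e p).1 hep)
      rwa [star_mul, hsa, hsa] at this
    have hx' : (e : H →L[ℂ] H) x = 0 := hx
    change (p : H →L[ℂ] H) x = 0
    rw [← h, mul_apply_eq_comp, hx', map_zero]
  have hUp (e : c) (x : H) : (U e).starProjection x = x - (e : H →L[ℂ] H) x := by
    refine Submodule.eq_starProjection_of_mem_orthogonal ?_ ?_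
    · change (e : H →L[ℂ] H) (x - (e : H →L[ℂ] H) x) = 0
      have := DFunLike.congr_fun (hidem e) x
      rw [mul_apply_eq_comp] at this
      rw [map_sub, this, sub_self]
    · rw [sub_sub_cancel, Submodule.mem_orthogonal]
      intro u hu
      have hu' : (e : H →L[ℂ] H) u = 0 := hu
      rw [(hc e e.2).2.inner_apply_apply, hu', inner_zero_left]
  let K := (⨆ e, U e).topologicalClosure
  have : CompleteSpace K := (⨆ e, U e).isClosed_topologicalClosure.completeSpace_coe
  have hlim (x : H) : Tendsto (fun e : c => (e : H →L[ℂ] H) x) atTop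
      (𝓝 ((1 - K.starProjection) x)) := by
    have h := (tendsto_const_nhds (x := x)).sub
      (Submodule.starProjection_tendsto_closure_iSup U hUm x)
    simpa [hUp] using h
  refine ⟨1 - K.starProjection, ?_, isStarProjection_starProjection.one_sub, ?_,
    map (fun e : c => (e : H →L[ℂ] H)) atTop, inferInstance, ?_, ?_⟩
  · rw [← SetLike.mem_coe, ← VonNeumannAlgebra.centralizer_centralizer]
    intro t ht
    ext x
    refine tendsto_nhds_unique (((t.continuous.tendsto _).comp (hlim x)).congr fun e => ?_)
      (hlim (t x))
    exact (DFunLike.congr_fun (ht e (hc e e.2).1) x).symm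
  · intro e he
    ext x
    refine tendsto_nhds_unique ((e.continuous.tendsto _).comp (hlim x)) ((hlim x).congr' ?_)
    filter_upwards [eventually_ge_atTop ⟨e, he⟩] with p hp
    exact (DFunLike.congr_fun ((hle _ _).1 hp) x).symm
  · exact eventually_map.2 (Eventually.of_forall fun e => e.2)
  · exact fun x => tendsto_map'_iff.2 (hlim x)

/-- Call a projection of `N` bad if it has no small symmetry. If `1` were bad, Zorn's lemma would
give a minimal bad projection `m`: a strong limit `p` of a chain of bad projections is bad, as
`e - p` has small mass for some `e` in the chain. But `m` is not a minimal projection, so it is the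
sum of two smaller projections; these are good, so `m` is. -/
theorem hasSmallSymmetry_one {ι : Type*} [Fintype ι] (N : VonNeumannAlgebra H)
    (hna : CARAlg.IsNonatomic N) (f : ι → H) {ε : ℝ} (hε : 0 < ε) :
    HasSmallSymmetry N f ε 1 := by
  by_contra hone
  let B := {e : H →L[ℂ] H // (e ∈ N ∧ IsStarProjection e) ∧ ¬ HasSmallSymmetry N f ε e}
  have : Nonempty B := ⟨⟨1, ⟨one_mem N, .one _⟩, hone⟩⟩
  have hbad (e : B) : ε < massOn f e.1 := by
    by_contra! h
    exact e.2.2 (.of_massOn_le e.2.1.1 e.2.1.2 h)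
  obtain ⟨m, hm⟩ := exists_maximal_of_nonempty_chains_bounded
    -- a maximal element for this relation is a minimal projection among the bad ones
    (r := fun e p : B => (e : H →L[ℂ] H) * p = (p : H →L[ℂ] H))
    (fun c hc hcne => by
      obtain ⟨p, hpN, hp, hle, l, hl, hlc, hlim⟩ := exists_inf_of_isChain N
        (c := Subtype.val '' c) (hcne.image _) (by rintro _ ⟨e, -, rfl⟩; exact e.2.1) (by
          rintro _ ⟨e, he, rfl⟩ _ ⟨p, hp, rfl⟩ hne
          exact hc he hp (fun h => hne (congrArg _ h)))
      refine ⟨⟨p, ⟨hpN, hp⟩, fun hgood => ?_⟩, fun e he => hle e ⟨e, he, rfl⟩⟩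
      have ht : Tendsto (fun e => massOn f (e - p)) l (𝓝 0) := by
        have : Tendsto (fun e => massOn f (e - p)) l
            (𝓝 (∑ i, ‖p (f i) - p (f i)‖ ^ 2)) :=
          tendsto_finsetSum _ fun i _ => (((hlim (f i)).sub_const _).norm.pow 2)
        simpa using this
      obtain ⟨e, hlt, e', he', rfl⟩ := ((ht.eventually_lt_const hε).and hlc).exists
      have hep : e'.1 * p = p := hle _ ⟨e', he', rfl⟩
      have hsub : IsStarProjection (e'.1 - p) := hp.sub_of_mul_eq_right e'.2.1.2 hep
      refine e'.2.2 ?_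
      rw [← sub_add_cancel e'.1 p]
      exact (HasSmallSymmetry.of_massOn_le (sub_mem e'.2.1.1 hpN) hsub hlt.le).add hsub
        (by rw [sub_mul, hep, hp.isIdempotentElem.eq, sub_self]) hgood)
    (fun {e p q} h₁ h₂ => by rw [← h₂, ← mul_assoc, h₁])
  have hm0 : m.1 ≠ 0 := by
    intro h0
    have := hbad m
    rw [h0] at this
    simp only [massOn, zero_apply, norm_zero] at this
    simp at this
    linarith
  refine hna ⟨m, m.2.1.1, m.2.1.2, hm0, fun q hqN hq hmq => ?_⟩
  by_contra! hq0
  have hqm : q * m.1 = q := by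
    have := congrArg star hmq
    rwa [star_mul, hq.isSelfAdjoint.star_eq, m.2.1.2.isSelfAdjoint.star_eq] at this
  have hsub : IsStarProjection (m.1 - q) := hq.sub_of_mul_eq_right m.2.1.2 hmq
  have h₁ : HasSmallSymmetry N f ε q := by
    by_contra h
    exact hq0.2 (hqm.symm.trans (hm ⟨q, ⟨hqN, hq⟩, h⟩ hmq))
  have h₂ : HasSmallSymmetry N f ε (m.1 - q) := by
    by_contra h
    have := hm ⟨m.1 - q, ⟨sub_mem m.2.1.1 hqN, hsub⟩, h⟩
      (by rw [mul_sub, hmq, m.2.1.2.isIdempotentElem.eq])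
    simp only [sub_mul, hqm, m.2.1.2.isIdempotentElem.eq, sub_eq_self] at this
    exact hq0.1 this
  refine m.2.2 ?_
  rw [← add_sub_cancel q m.1]
  exact h₁.add hq (by rw [mul_sub, hqm, hq.isIdempotentElem.eq, sub_self]) h₂

theorem exists_filter_of_forall_finset {X I : Type*} {Y : I → Type*}
    [∀ i, PseudoMetricSpace (Y i)] (g : X → ∀ i, Y i) (y : ∀ i, Y i) (S : Set X)
    (h : ∀ (s : Finset I) (ε : ℝ), 0 < ε → ∃ x ∈ S, ∀ i ∈ s, dist (g x i) (y i) < ε) :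
    ∃ l : Filter X, l.NeBot ∧ (∀ᶠ x in l, x ∈ S) ∧ ∀ i, Tendsto (fun x => g x i) l (𝓝 (y i)) := by
  classical
  choose x hxS hx using fun p : Finset I × ℕ => h p.1 (1 / (p.2 + 1)) Nat.one_div_pos_of_nat
  refine ⟨map x atTop, inferInstance, eventually_map.2 (Eventually.of_forall hxS), fun i => ?_⟩
  refine tendsto_map'_iff.2 (Metric.tendsto_atTop.2 fun ε hε => ?_)
  obtain ⟨n, hn⟩ := exists_nat_one_div_lt hε
  refine ⟨({i}, n), fun p hp => (hx p i (hp.1 (Finset.mem_singleton_self i))).trans_le ?_⟩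
  refine le_trans ?_ hn.le
  have : (n : ℝ) ≤ p.2 := by exact_mod_cast hp.2
  gcongr

theorem exists_filter_tendsto_of_mem_bicommutant (𝒜 : StarSubalgebra ℂ (H →L[ℂ] H))
    (hcl : IsClosed (𝒜 : Set (H →L[ℂ] H))) (V : unitary (H →L[ℂ] H))
    (hV : (V : H →L[ℂ] H) ∈ CARAlg.bicommutant (𝒜 : Set (H →L[ℂ] H))) :
    ∃ l : Filter (unitary (H →L[ℂ] H)), l.NeBot ∧
      (∀ᶠ U : unitary (H →L[ℂ] H) in l, (U : H →L[ℂ] H) ∈ 𝒜) ∧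
      ∀ f, Tendsto (fun U : unitary (H →L[ℂ] H) => (U : H →L[ℂ] H) f) l
        (𝓝 ((V : H →L[ℂ] H) f)) := by
  refine exists_filter_of_forall_finset (fun (U : unitary (H →L[ℂ] H)) f => (U : H →L[ℂ] H) f)
    (fun f => (V : H →L[ℂ] H) f) {U : unitary (H →L[ℂ] H) | (U : H →L[ℂ] H) ∈ 𝒜} fun s ε hε => ?_
  obtain ⟨U, hU, h⟩ := exists_unitary_approx_of_mem_bicommutant 𝒜 hcl V hV
    (fun f : s => (f : H)) hε
  exact ⟨U, hU, fun f hf => by simpa [dist_eq_norm] using h ⟨f, hf⟩⟩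

theorem exists_unitary_mem_norm_inner_lt (N : VonNeumannAlgebra H) (hna : CARAlg.IsNonatomic N)
    (s : Finset (H × H)) {ε : ℝ} (hε : 0 < ε) :
    ∃ U : unitary (H →L[ℂ] H), (U : H →L[ℂ] H) ∈ N ∧
      ∀ p ∈ s, ‖⟪p.1, (U : H →L[ℂ] H) p.2⟫_ℂ‖ < ε := by
  classical
  obtain ⟨t, ht⟩ : ∃ t : Finset H, ∀ p ∈ s, p.1 ∈ t ∧ p.2 ∈ t :=
    ⟨s.image Prod.fst ∪ s.image Prod.snd, fun p hp =>
      ⟨Finset.mem_union_left _ (Finset.mem_image_of_mem _ hp),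
        Finset.mem_union_right _ (Finset.mem_image_of_mem _ hp)⟩⟩
  obtain ⟨f, hf⟩ : ∃ f : t → H, ∀ j, f j = j := ⟨fun j => j, fun _ => rfl⟩
  have hM : 0 ≤ massOn f 1 := Finset.sum_nonneg fun _ _ => sq_nonneg _
  have hε' : 0 < ε ^ 2 / (massOn f 1 + 1) := by positivity
  obtain ⟨u, huN, hu, huu, hsmall⟩ := hasSmallSymmetry_one N hna f hε'
  have hU : u ∈ unitary (H →L[ℂ] H) := by
    rw [Unitary.mem_iff, hu.star_eq]; exact ⟨huu, huu⟩
  refine ⟨⟨u, hU⟩, huN, fun p hp => ?_⟩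
  have h3 : ‖⟪p.1, u p.2⟫_ℂ‖ ^ 2 ≤ matrixCoeffSq f u := by
    have h1 := Finset.single_le_sum (f := fun j : t => ‖⟪p.1, u (f j)⟫_ℂ‖ ^ 2)
      (fun _ _ => sq_nonneg _) (Finset.mem_univ ⟨p.2, (ht p hp).2⟩)
    have h2 := Finset.single_le_sum (f := fun i : t => ∑ j : t, ‖⟪f i, u (f j)⟫_ℂ‖ ^ 2)
      (fun _ _ => Finset.sum_nonneg fun _ _ => sq_nonneg _)
      (Finset.mem_univ ⟨p.1, (ht p hp).1⟩)
    simp only [hf] at h1 h2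
    simp only [matrixCoeffSq, hf]
    exact h1.trans h2
  have h4 : ε ^ 2 / (massOn f 1 + 1) * massOn f 1 < ε ^ 2 := by
    rw [div_mul_eq_mul_div, div_lt_iff₀ (by positivity)]
    nlinarith [pow_pos hε 2]
  exact lt_of_pow_lt_pow_left₀ 2 hε.le (h3.trans_lt (hsmall.trans_lt h4))

theorem exists_filter_inner_tendsto_zero (N : VonNeumannAlgebra H) (hna : CARAlg.IsNonatomic N) :
    ∃ l : Filter (unitary (H →L[ℂ] H)), l.NeBot ∧
      (∀ᶠ U : unitary (H →L[ℂ] H) in l, (U : H →L[ℂ] H) ∈ N) ∧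
      ∀ f g, Tendsto (fun U : unitary (H →L[ℂ] H) => ⟪f, (U : H →L[ℂ] H) g⟫_ℂ) l (𝓝 0) := by
  obtain ⟨l, hl, hlN, h⟩ := exists_filter_of_forall_finset
    (fun (U : unitary (H →L[ℂ] H)) (p : H × H) => ⟪p.1, (U : H →L[ℂ] H) p.2⟫_ℂ)
    (fun _ => 0) {U : unitary (H →L[ℂ] H) | (U : H →L[ℂ] H) ∈ N} fun s ε hε => by
      simpa only [dist_zero_right] using! exists_unitary_mem_norm_inner_lt N hna s hε
  exact ⟨l, hl, hlN, fun f g => h (f, g)⟩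

end Nonatomic

/-! ### Averaging over symmetries -/

section Average

variable {A : Type*} [CStarAlgebra A] {C : Type*} [CStarAlgebra C]

/-- The average `x ↦ (x + p x p) / 2` over the group `{1, p}`, meant for a symmetry `p`. -/
noncomputable def averageBy (p : A) : A →ₗ[ℂ] A :=
  (2⁻¹ : ℂ) • (LinearMap.id + LinearMap.mulLeftRight ℂ (p, p))

theorem averageBy_apply (p x : A) : averageBy p x = (2⁻¹ : ℂ) • (x + p * x * p) := by
  simp [averageBy]

/-- The successive averages over the members of a list, the head of the list coming first. -/
noncomputable def averageList : List A → A →ₗ[ℂ] A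
  | [] => LinearMap.id
  | p :: L => averageList L ∘ₗ averageBy p

@[simp]
theorem averageList_nil (x : A) : averageList [] x = x := rfl

@[simp]
theorem averageList_cons (p : A) (L : List A) (x : A) :
    averageList (p :: L) x = averageList L (averageBy p x) := rfl

theorem map_averageList (π : A →⋆ₐ[ℂ] C) (L : List A) (x : A) :
    π (averageList L x) = averageList (L.map π) (π x) := by
  induction L generalizing x with
  | nil => rfl
  | cons p L ih => simp [ih, averageBy_apply]

/-- A symmetry: a self-adjoint unitary. -/
def IsSymmetry (p : A) : Prop := IsSelfAdjoint p ∧ p * p = 1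

theorem IsSymmetry.map {p : A} (hp : IsSymmetry p) (π : A →⋆ₐ[ℂ] C) : IsSymmetry (π p) :=
  ⟨hp.1.map π, by rw [← map_mul, hp.2, map_one]⟩

theorem IsSymmetry.mem_unitary {p : A} (hp : IsSymmetry p) : p ∈ unitary A := by
  rw [Unitary.mem_iff, hp.1.star_eq]; exact ⟨hp.2, hp.2⟩

theorem norm_averageBy_le {p : A} (hp : IsSymmetry p) (x : A) : ‖averageBy p x‖ ≤ ‖x‖ := by
  have h : ‖p * x * p‖ = ‖x‖ := by
    rw [CStarRing.norm_mul_mem_unitary _ hp.mem_unitary,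
      CStarRing.norm_mem_unitary_mul _ hp.mem_unitary]
  have := norm_add_le x (p * x * p)
  rw [averageBy_apply, norm_smul]
  norm_num
  linarith

theorem norm_averageList_le {L : List A} (hL : ∀ p ∈ L, IsSymmetry p) (x : A) :
    ‖averageList L x‖ ≤ ‖x‖ := by
  induction L generalizing x with
  | nil => simp
  | cons p L ih =>
    rw [List.forall_mem_cons] at hL
    exact (ih hL.2 _).trans (norm_averageBy_le hL.1 x)

theorem averageList_of_commute {L : List A} (hL : ∀ p ∈ L, IsSymmetry p) {x : A}
    (hx : ∀ p ∈ L, p * x = x * p) : averageList L x = x := by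
  induction L with
  | nil => simp
  | cons p L ih =>
    rw [List.forall_mem_cons] at hL hx
    have : averageBy p x = x := by
      rw [averageBy_apply, hx.1, mul_assoc, hL.1.2, mul_one, ← two_smul ℂ, smul_smul]
      norm_num
    rw [averageList_cons, this, ih hL.2 hx.2]

/-- Averages are faithful on positive elements, with a bound: each step satisfies
`x ≤ x + p x p = 2 • averageBy p x`. -/
theorem norm_le_two_pow_mul_norm_averageList [PartialOrder A] [StarOrderedRing A] {L : List A}
    (hL : ∀ p ∈ L, IsSymmetry p) {x : A} (hx : 0 ≤ x) :
    ‖x‖ ≤ 2 ^ L.length * ‖averageList L x‖ := by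
  induction L generalizing x with
  | nil => simp
  | cons p L ih =>
    rw [List.forall_mem_cons] at hL
    have h1 : 0 ≤ p * x * p := hL.1.1.conjugate_nonneg hx
    have h2 : x + p * x * p = (2 : ℂ) • averageBy p x := by
      rw [averageBy_apply, smul_smul]; norm_num
    have h3 : 0 ≤ averageBy p x := by
      have : averageBy p x = (2⁻¹ : ℝ) • (x + p * x * p) := by
        rw [averageBy_apply, ← Complex.coe_smul]; norm_num
      rw [this]
      exact smul_nonneg (by norm_num) (add_nonneg hx h1)
    have h4 : ‖x‖ ≤ ‖x + p * x * p‖ :=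
      CStarAlgebra.norm_le_norm_of_nonneg_of_le hx (le_add_of_nonneg_right h1)
    rw [h2, norm_smul] at h4
    have h5 := ih hL.2 h3
    rw [averageList_cons, List.length_cons, pow_succ]
    norm_num at h4
    linarith

end Average

/-! ### Adjoining a commuting matrix unit -/

section MatrixUnit

variable {A : Type*} [CStarAlgebra A]

/-- If `e` is a matrix unit `e₁₂` of a copy of `M₂(ℂ)` that commutes with `B`, the algebra generated
by `B` and `e` consists of the combinations of `1`, `e`, `e⋆`, `e e⋆` with coefficients in `B`. -/
theorem exists_eq_of_mem_adjoin_insert (B : StarSubalgebra ℂ A) {e : A} (he : e * e = 0)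
    (hee : e * star e + star e * e = 1) (hB : ∀ b ∈ B, e * b = b * e) {x : A}
    (hx : x ∈ StarAlgebra.adjoin ℂ (insert e (B : Set A))) :
    ∃ y₀ ∈ B, ∃ y₁ ∈ B, ∃ y₂ ∈ B, ∃ y₃ ∈ B,
      x = y₀ + y₁ * e + y₂ * star e + y₃ * (e * star e) := by
  have hB' : ∀ b ∈ B, star e * b = b * star e := fun b hb => by
    simpa using (congrArg star (hB _ (star_mem hb))).symm
  have he' : star e * star e = 0 := by simpa using congrArg star he
  have h1 : star e * e = 1 - e * star e := by rw [← hee]; abel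
  have h2 : star e * (e * star e) = star e := by
    rw [← mul_assoc, h1, sub_mul, mul_assoc, he']; simp
  let T : Submodule ℂ A :=
    { carrier := {x | ∃ y₀ ∈ B, ∃ y₁ ∈ B, ∃ y₂ ∈ B, ∃ y₃ ∈ B,
        x = y₀ + y₁ * e + y₂ * star e + y₃ * (e * star e)}
      add_mem' := by
        rintro _ _ ⟨y₀, h₀, y₁, h₁, y₂, h₂, y₃, h₃, rfl⟩ ⟨z₀, k₀, z₁, k₁, z₂, k₂, z₃, k₃, rfl⟩
        exact ⟨_, add_mem h₀ k₀, _, add_mem h₁ k₁, _, add_mem h₂ k₂, _, add_mem h₃ k₃,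
          by simp only [add_mul]; abel⟩
      zero_mem' := ⟨0, zero_mem _, 0, zero_mem _, 0, zero_mem _, 0, zero_mem _, by simp⟩
      smul_mem' := by
        rintro c _ ⟨y₀, h₀, y₁, h₁, y₂, h₂, y₃, h₃, rfl⟩
        exact ⟨_, SMulMemClass.smul_mem c h₀, _, SMulMemClass.smul_mem c h₁, _,
          SMulMemClass.smul_mem c h₂, _, SMulMemClass.smul_mem c h₃,
          by simp only [smul_add, smul_mul_assoc]⟩ }
  -- stability of `T` under left multiplication needs to be checked on generators only
  have hT : ∀ t ∈ T, x * t ∈ T := by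
    rw [← StarSubalgebra.mem_toSubalgebra, StarAlgebra.adjoin_toSubalgebra] at hx
    induction hx using Algebra.adjoin_induction with
    | mem g hg =>
      rintro _ ⟨y₀, h₀, y₁, h₁, y₂, h₂, y₃, h₃, rfl⟩
      have hge : g ∈ B ∨ g = e ∨ g = star e := by
        rcases hg with (hg | hg) | hg
        · exact .inr (.inl hg)
        · exact .inl hg
        · rcases hg with hg | hg
          · exact .inr (.inr (by rw [← hg, star_star]))
          · exact .inl (by simpa using star_mem (s := B) hg)
      rcases hge with hg | rfl | rfl
      · exact ⟨_, mul_mem hg h₀, _, mul_mem hg h₁, _, mul_mem hg h₂, _, mul_mem hg h₃,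
          by simp only [mul_add, mul_assoc]⟩
      · refine ⟨0, zero_mem _, _, h₀, 0, zero_mem _, _, h₂, ?_⟩
        simp only [mul_add, ← mul_assoc, hB _ h₀, hB _ h₁, hB _ h₂, hB _ h₃]
        simp only [mul_assoc, he]
        simp
      · refine ⟨_, h₁, 0, zero_mem _, _, add_mem h₀ h₃, -y₁, neg_mem h₁, ?_⟩
        simp only [mul_add, ← mul_assoc, hB' _ h₀, hB' _ h₁, hB' _ h₂, hB' _ h₃]
        simp only [mul_assoc, he', h2]
        simp only [h1, mul_sub, add_mul, neg_mul, mul_one, mul_zero, zero_mul]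
        abel
    | algebraMap c =>
      intro t ht
      rw [← Algebra.smul_def]
      exact T.smul_mem c ht
    | add a b _ _ h₁ h₂ => exact fun t ht => by rw [add_mul]; exact T.add_mem (h₁ t ht) (h₂ t ht)
    | mul a b _ _ h₁ h₂ => exact fun t ht => by rw [mul_assoc]; exact h₁ _ (h₂ t ht)
  have := hT 1 ⟨1, one_mem _, 0, zero_mem _, 0, zero_mem _, 0, zero_mem _, by simp⟩
  rwa [mul_one] at this

/-- Averaging over the Pauli matrices `q = e e⋆ - e⋆ e` and `p = e + e⋆` is the conditional
expectation `b ⊗ m ↦ tr(m) b / 2` onto `B`. -/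
theorem exists_symmetries_average_mem (B : StarSubalgebra ℂ A) {e : A} (he : e * e = 0)
    (hee : e * star e + star e * e = 1) (hB : ∀ b ∈ B, e * b = b * e) :
    ∃ p q : A, IsSymmetry p ∧ IsSymmetry q ∧
      ∀ x ∈ StarAlgebra.adjoin ℂ (insert e (B : Set A)), averageBy p (averageBy q x) ∈ B := by
  have hB' : ∀ b ∈ B, star e * b = b * star e := fun b hb => by
    simpa using (congrArg star (hB _ (star_mem hb))).symm
  have he' : star e * star e = 0 := by simpa using congrArg star he
  have h1 : star e * e = 1 - e * star e := by rw [← hee]; abel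
  have h2 : star e * (e * star e) = star e := by
    rw [← mul_assoc, h1, sub_mul, mul_assoc, he']; simp
  have h3 : e * (star e * e) = e := by
    rw [h1, mul_sub, ← mul_assoc, he]; simp
  set q : A := e * star e - star e * e with hq
  set p : A := e + star e with hp
  have hpp : p * p = 1 := by
    rw [← hee, hp]; simp [mul_add, add_mul, he, he']; abel
  have hqe : q * e = e := by rw [hq, sub_mul, mul_assoc, h3, mul_assoc, he]; simp
  have heq : e * q = -e := by rw [hq, mul_sub, h3, ← mul_assoc, he]; simp
  have hqe' : q * star e = -star e := by rw [hq, sub_mul, mul_assoc, he', mul_assoc, h2]; simp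
  have heq' : star e * q = star e := by rw [hq, mul_sub, h2, ← mul_assoc, he']; simp
  have hqq : q * q = 1 := by
    conv_lhs => rw [hq, sub_mul, mul_assoc, heq', mul_assoc, heq]
    rw [mul_neg, sub_neg_eq_add, hee]
  have hqB : ∀ b ∈ B, q * b = b * q := fun b hb => by
    rw [hq, sub_mul, mul_sub, mul_assoc, hB' b hb, ← mul_assoc, hB b hb, mul_assoc (star e),
      hB b hb, ← mul_assoc (star e), hB' b hb, mul_assoc, mul_assoc]
  have hpB : ∀ b ∈ B, p * b = b * p := fun b hb => by
    rw [hp, add_mul, mul_add, hB b hb, hB' b hb]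
  refine ⟨p, q, ⟨by simp [hp, IsSelfAdjoint, add_comm], hpp⟩,
    ⟨by simp [hq, IsSelfAdjoint], hqq⟩, fun x hx => ?_⟩
  obtain ⟨y₀, h₀, y₁, h₁, y₂, h₂, y₃, h₃, rfl⟩ := exists_eq_of_mem_adjoin_insert B he hee hB hx
  have hA : averageBy q (y₀ + y₁ * e + y₂ * star e + y₃ * (e * star e)) =
      y₀ + y₃ * (e * star e) := by
    have c0 : q * y₀ * q = y₀ := by rw [hqB _ h₀, mul_assoc, hqq, mul_one]
    have c1 : q * (y₁ * e) * q = -(y₁ * e) := by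
      rw [← mul_assoc, hqB _ h₁, mul_assoc, mul_assoc, heq, mul_neg, hqe, mul_neg]
    have c2 : q * (y₂ * star e) * q = -(y₂ * star e) := by
      rw [← mul_assoc, hqB _ h₂, mul_assoc, mul_assoc, heq', hqe', mul_neg]
    have c3 : q * (y₃ * (e * star e)) * q = y₃ * (e * star e) := by
      rw [← mul_assoc, hqB _ h₃, mul_assoc, mul_assoc, mul_assoc, heq', ← mul_assoc q, hqe]
    rw [averageBy_apply]
    simp only [mul_add, add_mul, c0, c1, c2, c3]
    module
  have hA' : averageBy p (y₀ + y₃ * (e * star e)) = y₀ + (2⁻¹ : ℂ) • y₃ := by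
    have c0 : p * y₀ * p = y₀ := by rw [hpB _ h₀, mul_assoc, hpp, mul_one]
    have c3 : p * (y₃ * (e * star e)) * p = y₃ * (star e * e) := by
      have d1 : p * e = star e * e := by rw [hp, add_mul, he, zero_add]
      have d2 : star e * p = star e * e := by rw [hp, mul_add, he', add_zero]
      rw [← mul_assoc, hpB _ h₃, mul_assoc, mul_assoc, mul_assoc, d2, ← mul_assoc p, d1,
        mul_assoc, h3]
    rw [averageBy_apply]
    simp only [mul_add, add_mul, c0, c3]
    have : y₃ = y₃ * (e * star e) + y₃ * (star e * e) := by rw [← mul_add, hee, mul_one]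
    conv_rhs => rw [this]
    module
  rw [hA, hA']
  exact add_mem h₀ (SMulMemClass.smul_mem _ h₃)

end MatrixUnit

/-! ### Consequences of the canonical anticommutation relations -/

section Relations

variable {H : Type*} [NormedAddCommGroup H] [InnerProductSpace ℂ H]
  {A : Type*} [CStarAlgebra A] {C : Type*} [CStarAlgebra C]

/-- The canonical anticommutation relations for an antilinear map `a`, with no condition on the
algebra generated by its image. -/
structure SatisfiesCAR (a : H →ₛₗ[starRingEnd ℂ] A) : Prop where
  anticomm_star : ∀ f g : H, a f * star (a g) + star (a g) * a f = ⟪f, g⟫_ℂ • (1 : A)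
  anticomm : ∀ f g : H, a f * a g + a g * a f = 0

namespace SatisfiesCAR

variable {a : H →ₛₗ[starRingEnd ℂ] A}

theorem mul_self (ha : SatisfiesCAR a) (f : H) : a f * a f = 0 := by
  have h := ha.anticomm f f
  rw [← two_smul ℂ] at h
  exact (smul_eq_zero.1 h).resolve_left two_ne_zero

/-- For finitely many orthonormal vectors, some average over symmetries maps the algebra generated
by the `a (e i)` into the scalars. The induction adds one mode `b = a (e j)` at a time and carries
along the parity `v` of the previous modes, a symmetry that anticommutes with them and commutes
with all orthogonal modes. The matrix unit `v b` commutes with the algebra of the previous modes.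
-/
theorem exists_averageList (ha : SatisfiesCAR a) {ι : Type*} {e : ι → H} (he : Orthonormal ℂ e)
    (s : Finset ι) : ∃ (L : List A) (v : A), (∀ p ∈ L, IsSymmetry p) ∧ IsSymmetry v ∧
      v ∈ StarAlgebra.adjoin ℂ ((fun i => a (e i)) '' s) ∧
      (∀ i ∈ s, v * a (e i) = -(a (e i) * v)) ∧
      (∀ g, (∀ i ∈ s, ⟪e i, g⟫_ℂ = 0) → v * a g = a g * v) ∧
      ∀ x ∈ StarAlgebra.adjoin ℂ ((fun i => a (e i)) '' s), ∃ c : ℂ,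
        averageList L x = c • (1 : A) := by
  classical
  induction s using Finset.induction_on with
  | empty =>
    refine ⟨[], 1, by simp, ⟨.one A, one_mul 1⟩, one_mem _, by simp, by simp, fun x hx => ?_⟩
    have hx' : x ∈ (⊥ : StarSubalgebra ℂ A) := (StarAlgebra.adjoin_le (by simp)) hx
    obtain ⟨c, rfl⟩ := StarSubalgebra.mem_bot.1 hx'
    exact ⟨c, by simp [Algebra.algebraMap_eq_smul_one]⟩
  | insert j s hj ih =>
    obtain ⟨L, v, hL, hv, hvD, hvs, hvc, havg⟩ := ih
    set D := StarAlgebra.adjoin ℂ ((fun i => a (e i)) '' (s : Set ι)) with hD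
    set D' := StarAlgebra.adjoin ℂ ((fun i => a (e i)) '' ((insert j s : Finset ι) : Set ι))
      with hD'
    set b := a (e j) with hb
    have hDD' : D ≤ D' := StarAlgebra.adjoin_mono (Set.image_mono (by simp))
    have hbD' : b ∈ D' := StarAlgebra.subset_adjoin ℂ _ ⟨j, by simp, rfl⟩
    have hjs : ∀ i ∈ s, ⟪e i, e j⟫_ℂ = 0 := fun i hi => he.2 (fun h => hj (h ▸ hi))
    have hjs' : ∀ i ∈ s, ⟪e j, e i⟫_ℂ = 0 := fun i hi => he.2 (fun h => hj (h ▸ hi))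
    have hvb : v * b = b * v := hvc _ hjs
    have hvb' : v * star b = star b * v := by
      simpa [hv.1.star_eq] using (congrArg star hvb).symm
    have hbb : b * b = 0 := ha.mul_self _
    have hbb' : star b * star b = 0 := by simpa using congrArg star hbb
    have hbs : b * star b + star b * b = 1 := by
      rw [hb, ha.anticomm_star, inner_self_eq_norm_sq_to_K, he.1 j]; simp
    -- the twisted annihilator `v b` commutes with `D`
    have hwD : ∀ x ∈ D, (v * b) * x = x * (v * b) := by
      have hD2 : D ≤ StarSubalgebra.centralizer ℂ {v * b} := by
        refine StarAlgebra.adjoin_le ?_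
        rintro _ ⟨i, hi, rfl⟩
        have c1 : b * a (e i) = -(a (e i) * b) := eq_neg_of_add_eq_zero_left (ha.anticomm _ _)
        have c2 : star b * a (e i) = -(a (e i) * star b) := by
          have := ha.anticomm_star (e i) (e j)
          rw [hjs i hi, zero_smul, add_comm] at this
          exact eq_neg_of_add_eq_zero_left this
        rw [SetLike.mem_coe, StarSubalgebra.mem_centralizer_iff]
        rintro _ rfl
        simp only [star_mul, hv.1.star_eq]
        constructor
        · rw [mul_assoc, c1, mul_neg, ← mul_assoc, hvs i hi, neg_mul, neg_neg, mul_assoc]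
        · rw [mul_assoc, hvs i hi, mul_neg, ← mul_assoc, c2, neg_mul, neg_neg, mul_assoc]
      intro x hx
      exact ((StarSubalgebra.mem_centralizer_iff ℂ).1 (hD2 hx) _ rfl).1
    have hw1 : (v * b) * (v * b) = 0 := by
      rw [mul_assoc, ← mul_assoc b, ← hvb, mul_assoc v, hbb]; simp
    have hws : star (v * b) = star b * v := by rw [star_mul, hv.1.star_eq]
    have hw2 : (v * b) * star (v * b) + star (v * b) * (v * b) = 1 := by
      rw [hws, ← hvb', mul_assoc v b, ← mul_assoc b v, ← hvb,
        mul_assoc v (star b), ← mul_assoc (star b) v, ← hvb']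
      simp only [← mul_assoc, hv.2, one_mul]
      exact hbs
    obtain ⟨p, q, hp, hq, hpq⟩ := exists_symmetries_average_mem D hw1 hw2 hwD
    have hD'le : D' ≤ StarAlgebra.adjoin ℂ (insert (v * b) (D : Set A)) := by
      refine StarAlgebra.adjoin_le ?_
      have hsub := StarAlgebra.subset_adjoin ℂ (insert (v * b) (D : Set A))
      rintro _ ⟨i, hi, rfl⟩
      rcases Finset.mem_insert.1 hi with rfl | hi
      · have : b = v * (v * b) := by rw [← mul_assoc, hv.2, one_mul]
        change b ∈ StarAlgebra.adjoin ℂ (insert (v * b) (D : Set A))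
        refine Set.mem_of_eq_of_mem this ?_
        exact mul_mem (hsub (.inr hvD)) (hsub (.inl rfl))
      · exact hsub (.inr (StarAlgebra.subset_adjoin ℂ _ ⟨i, hi, rfl⟩))
    -- the parity of the new mode
    set r : A := 1 - (2 : ℂ) • (star b * b) with hr
    have hbsb : b * (star b * b) = b := by
      have := congrArg (b * ·) hbs
      simpa [mul_add, ← mul_assoc, hbb] using this
    have hrb : r * b = b := by rw [hr, sub_mul, smul_mul_assoc, mul_assoc, hbb]; simp
    have hbr : b * r = -b := by rw [hr, mul_sub, mul_smul_comm, hbsb, mul_one]; module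
    have hrsa : IsSelfAdjoint r := by
      simp [hr, IsSelfAdjoint, star_smul]
    have hrr : r * r = 1 := by
      conv_lhs => rw [hr, sub_mul, smul_mul_assoc, mul_assoc, hbr]
      simp only [one_mul, mul_neg]; module
    have hvr : v * r = r * v := by
      rw [hr, mul_sub, sub_mul, mul_smul_comm, smul_mul_assoc, ← mul_assoc, hvb', mul_assoc, hvb,
        mul_assoc]; simp
    have hrD' : r ∈ D' := sub_mem (one_mem _)
      (SMulMemClass.smul_mem _ (mul_mem (star_mem hbD') hbD'))
    have hrg : ∀ g, ⟪e j, g⟫_ℂ = 0 → r * a g = a g * r := by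
      intro g hg
      have c1 : b * a g = -(a g * b) := eq_neg_of_add_eq_zero_left (ha.anticomm _ _)
      have c2 : star b * a g = -(a g * star b) := by
        have := ha.anticomm_star g (e j)
        rw [← inner_conj_symm, hg, map_zero, zero_smul, add_comm] at this
        exact eq_neg_of_add_eq_zero_left this
      rw [hr, sub_mul, mul_sub, smul_mul_assoc, mul_smul_comm, mul_assoc, c1, mul_neg, ← mul_assoc,
        c2, neg_mul, neg_neg, mul_assoc]; simp
    refine ⟨q :: p :: L, v * r, ?_, ⟨?_, ?_⟩, mul_mem (hDD' hvD) hrD', ?_, ?_, ?_⟩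
    · simpa [hp, hq] using hL
    · rw [IsSelfAdjoint, star_mul, hv.1.star_eq, hrsa.star_eq, hvr]
    · rw [mul_assoc, ← mul_assoc r, ← hvr, mul_assoc v r, hrr, mul_one, hv.2]
    · intro i hi
      rcases Finset.mem_insert.1 hi with rfl | hi
      · rw [mul_assoc, ← hb, hrb, hvb, hvr, ← mul_assoc, hbr, neg_mul, neg_neg]
      · rw [mul_assoc, hrg _ (hjs' i hi), ← mul_assoc, hvs i hi, neg_mul, mul_assoc]
    · intro g hg
      rw [mul_assoc, hrg g (hg j (Finset.mem_insert_self _ _)), ← mul_assoc,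
        hvc g fun i hi => hg i (Finset.mem_insert_of_mem hi), mul_assoc]
    · intro x hx
      exact havg _ (hpq x (hD'le hx))

theorem exists_averageList_of_mem_adjoin (ha : SatisfiesCAR a) {x : A}
    (hx : x ∈ StarAlgebra.adjoin ℂ (Set.range a)) : ∃ L : List A, (∀ p ∈ L, IsSymmetry p) ∧
      ∀ y ∈ StarAlgebra.adjoin ℂ {x}, ∃ c : ℂ, averageList L y = c • (1 : A) := by
  classical
  obtain ⟨F, hF⟩ : ∃ F : Finset H, x ∈ StarAlgebra.adjoin ℂ (a '' (F : Set H)) := by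
    have hmono (F G : Finset H) (h : F ⊆ G) : StarAlgebra.adjoin ℂ (a '' (F : Set H)) ≤
        StarAlgebra.adjoin ℂ (a '' (G : Set H)) :=
      StarAlgebra.adjoin_mono (Set.image_mono (Finset.coe_subset.2 h))
    induction hx using StarAlgebra.adjoin_induction with
    | mem x hx =>
      obtain ⟨f, rfl⟩ := hx
      exact ⟨{f}, StarAlgebra.subset_adjoin ℂ _ ⟨f, by simp, rfl⟩⟩
    | algebraMap c => exact ⟨∅, algebraMap_mem _ c⟩
    | add x y _ _ h₁ h₂ =>
      obtain ⟨F, hF⟩ := h₁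
      obtain ⟨G, hG⟩ := h₂
      exact ⟨F ∪ G, add_mem (hmono _ _ Finset.subset_union_left hF)
        (hmono _ _ Finset.subset_union_right hG)⟩
    | mul x y _ _ h₁ h₂ =>
      obtain ⟨F, hF⟩ := h₁
      obtain ⟨G, hG⟩ := h₂
      exact ⟨F ∪ G, mul_mem (hmono _ _ Finset.subset_union_left hF)
        (hmono _ _ Finset.subset_union_right hG)⟩
    | star x _ h =>
      obtain ⟨F, hF⟩ := h
      exact ⟨F, star_mem hF⟩
  let W := Submodule.span ℂ (F : Set H)
  let b := stdOrthonormalBasis ℂ W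
  have hb : Orthonormal ℂ fun i => (b i : H) := b.orthonormal.comp_linearIsometry W.subtypeₗᵢ
  obtain ⟨L, v, hL, -, -, -, -, h⟩ := ha.exists_averageList hb Finset.univ
  set D := StarAlgebra.adjoin ℂ ((fun i => a (b i : H)) ''
    ((Finset.univ : Finset (Fin (Module.finrank ℂ W))) : Set (Fin (Module.finrank ℂ W)))) with hD
  have hfD : ∀ f ∈ F, a f ∈ D := by
    intro f hf
    have hf' := b.sum_repr ⟨f, Submodule.subset_span hf⟩
    have hf2 := congrArg Subtype.val hf'
    simp only [Submodule.coe_sum, Submodule.coe_smul] at hf2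
    rw [← hf2, map_sum]
    refine sum_mem fun i _ => ?_
    rw [map_smulₛₗ]
    exact SMulMemClass.smul_mem _ (StarAlgebra.subset_adjoin ℂ _ ⟨i, by simp, rfl⟩)
  have hxD : x ∈ D := (StarAlgebra.adjoin_le (by rintro _ ⟨f, hf, rfl⟩; exact hfD f hf)) hF
  exact ⟨L, hL, fun y hy => h y (StarAlgebra.adjoin_le (by simpa using hxD) hy)⟩

/-- Every unital `*`-homomorphism to a nonzero algebra is isometric on the `*`-polynomials in the
`a f`. For `h = x⋆ x` the average of `h ^ m` is a scalar `c`, so that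
`‖h‖ ^ m ≤ 2 ^ L.length * |c|`, and `|c| ≤ ‖π h‖ ^ m` since `π` commutes with averaging. Taking
`m`-th roots gives `‖h‖ ≤ ‖π h‖`. -/
theorem norm_map_eq [Nontrivial C] (ha : SatisfiesCAR a) (π : A →⋆ₐ[ℂ] C) {x : A}
    (hx : x ∈ StarAlgebra.adjoin ℂ (Set.range a)) : ‖π x‖ = ‖x‖ := by
  let _ := CStarAlgebra.spectralOrder A
  let _ := CStarAlgebra.spectralOrderedRing A
  refine le_antisymm (NonUnitalStarAlgHom.norm_apply_le π x) ?_
  obtain ⟨L, hL, hx'⟩ := ha.exists_averageList_of_mem_adjoin hx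
  have : Nontrivial A := π.toRingHom.domain_nontrivial
  set h := star x * x with hh
  have hsa : IsSelfAdjoint h := .star_mul_self x
  have hmem : h ∈ StarAlgebra.adjoin ℂ {x} :=
    mul_mem (star_mem (StarAlgebra.self_mem_adjoin_singleton ℂ x))
      (StarAlgebra.self_mem_adjoin_singleton ℂ x)
  have key (n : ℕ) : ‖h‖ ^ (2 ^ n) ≤ 2 ^ L.length * ‖π h‖ ^ (2 ^ n) := by
    obtain ⟨c, hc⟩ := hx' _ (pow_mem hmem (2 ^ n))
    have h0 : 0 ≤ h := star_mul_self_nonneg x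
    have h1 := norm_le_two_pow_mul_norm_averageList hL (CStarAlgebra.pow_nonneg h0 (2 ^ n))
    have h2 : ‖h ^ (2 ^ n)‖ = ‖h‖ ^ (2 ^ n) := by
      have := hsa.nnnorm_pow_two_pow n
      exact congrArg NNReal.toReal this
    have h3 : ‖averageList L (h ^ 2 ^ n)‖ ≤ ‖π h‖ ^ 2 ^ n := by
      have h4 := map_averageList π L (h ^ 2 ^ n)
      rw [hc, map_smul, map_one] at h4
      have h5 := congrArg norm h4
      rw [norm_smul, CStarRing.norm_one, mul_one] at h5
      rw [hc, norm_smul, CStarRing.norm_one, mul_one, h5]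
      refine (norm_averageList_le (by simpa using fun p hp => (hL p hp).map π) _).trans ?_
      rw [map_pow]
      exact norm_pow_le _ _
    rw [h2] at h1
    exact h1.trans (by gcongr)
  have hle : ‖h‖ ≤ ‖π h‖ := by
    by_contra! hlt
    have hpos : 0 < ‖h‖ := (norm_nonneg _).trans_lt hlt
    have hr : ‖π h‖ / ‖h‖ < 1 := (div_lt_one hpos).2 hlt
    have hr0 : 0 ≤ ‖π h‖ / ‖h‖ := by positivity
    obtain ⟨n, hn⟩ := exists_pow_lt_of_lt_one (show (0 : ℝ) < (2 ^ L.length)⁻¹ by positivity) hr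
    have h1 : (‖π h‖ / ‖h‖) ^ 2 ^ n < (2 ^ L.length)⁻¹ :=
      (pow_le_pow_of_le_one hr0 hr.le Nat.lt_two_pow_self.le).trans_lt hn
    rw [div_pow, div_lt_iff₀ (by positivity), inv_mul_eq_div, lt_div_iff₀ (by positivity)] at h1
    linarith [key n]
  rw [hh, map_mul, map_star, CStarRing.norm_star_mul_self, CStarRing.norm_star_mul_self] at hle
  exact (mul_self_le_mul_self_iff (norm_nonneg _) (norm_nonneg _)).2 hle

/-- A CAR-algebra has trivial center: averaging fixes a central element, and maps the polynomials
that approximate it to scalars. -/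
theorem mem_bot_of_forall_commute (ha : SatisfiesCAR a)
    (hgen : (StarAlgebra.adjoin ℂ (Set.range a)).topologicalClosure = ⊤) {x : A}
    (hx : ∀ y, y * x = x * y) : x ∈ (⊥ : StarSubalgebra ℂ A) := by
  obtain _ | _ := subsingleton_or_nontrivial A
  · rw [Subsingleton.elim x 1]; exact one_mem _
  have hcl : IsClosed ((ℂ ∙ (1 : A) : Submodule ℂ A) : Set A) :=
    Submodule.closed_of_finiteDimensional _
  have hmem : x ∈ closure ((ℂ ∙ (1 : A) : Submodule ℂ A) : Set A) := by
    refine Metric.mem_closure_iff.2 fun ε hε => ?_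
    have hx1 : x ∈ closure (StarAlgebra.adjoin ℂ (Set.range a) : Set A) := by
      rw [← StarSubalgebra.topologicalClosure_coe, hgen]; trivial
    obtain ⟨y, hy, hxy⟩ := Metric.mem_closure_iff.1 hx1 ε hε
    obtain ⟨L, hL, h⟩ := ha.exists_averageList_of_mem_adjoin hy
    obtain ⟨c, hc⟩ := h y (StarAlgebra.self_mem_adjoin_singleton ℂ y)
    refine ⟨c • 1, Submodule.smul_mem _ _ (Submodule.mem_span_singleton_self 1), ?_⟩
    rw [dist_eq_norm] at hxy ⊢
    have hLx : averageList L x = x := averageList_of_commute hL fun p _ => hx p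
    rw [← hc, ← hLx, ← map_sub]
    exact (norm_averageList_le hL _).trans_lt hxy
  rw [hcl.closure_eq] at hmem
  obtain ⟨c, rfl⟩ := Submodule.mem_span_singleton.1 hmem
  exact SMulMemClass.smul_mem c (one_mem _)

end SatisfiesCAR

end Relations

/-! ### Uniqueness of the CAR-algebra -/

section Uniqueness

variable {H : Type*} [NormedAddCommGroup H] [InnerProductSpace ℂ H]
  {A : Type*} [CStarAlgebra A] {C : Type*} [CStarAlgebra C]

theorem starAlgEquiv_ext_of_adjoin {s : Set A}
    (hs : (StarAlgebra.adjoin ℂ s).topologicalClosure = ⊤) {φ ψ : A ≃⋆ₐ[ℂ] C}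
    (h : ∀ x ∈ s, φ x = ψ x) : φ = ψ := by
  have hφ : Continuous φ := (NonUnitalStarAlgHom.isometry φ φ.injective).continuous
  have hψ : Continuous ψ := (NonUnitalStarAlgHom.isometry ψ ψ.injective).continuous
  have hle : (StarAlgebra.adjoin ℂ s).topologicalClosure ≤
      StarAlgHom.equalizer (φ : A →⋆ₐ[ℂ] C) (ψ : A →⋆ₐ[ℂ] C) :=
    StarSubalgebra.topologicalClosure_minimal (StarAlgebra.adjoin_le h) (isClosed_eq hφ hψ)
  rw [hs] at hle
  exact DFunLike.ext _ _ fun x => hle (StarSubalgebra.mem_top (x := x))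

namespace SatisfiesCAR

variable {d : H →ₛₗ[starRingEnd ℂ] C} {a : H →ₛₗ[starRingEnd ℂ] A}

/-- An isometric homomorphism has closed range, so it is onto as soon as the image of the generators
generates. -/
theorem bijective_comp_subtype [Nontrivial A] (hd : SatisfiesCAR d) (π : C →⋆ₐ[ℂ] A)
    (hgen : (StarAlgebra.adjoin ℂ (Set.range fun f => π (d f))).topologicalClosure = ⊤) :
    Function.Bijective
      (π.comp (StarAlgebra.adjoin ℂ (Set.range d)).topologicalClosure.subtype) := by
  set D := (StarAlgebra.adjoin ℂ (Set.range d)).topologicalClosure with hD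
  have : CompleteSpace D := (StarSubalgebra.isClosed_topologicalClosure _).completeSpace_coe
  have hπ : Continuous π := AddMonoidHomClass.continuous_of_bound π 1 fun x => by
    simpa using NonUnitalStarAlgHom.norm_apply_le π x
  have hnorm : ∀ x : D, ‖π.comp D.subtype x‖ = ‖x‖ := by
    intro x
    have hcl : IsClosed {x : C | ‖π x‖ = ‖x‖} := isClosed_eq hπ.norm continuous_norm
    exact closure_minimal (fun y hy => hd.norm_map_eq π hy) hcl x.2
  have hiso : Isometry (π.comp D.subtype) := AddMonoidHomClass.isometry_of_norm _ hnorm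
  refine ⟨hiso.injective, fun y => ?_⟩
  have hcl : IsClosed ((π.comp D.subtype).range : Set A) := by
    have hr : ((π.comp D.subtype).range : Set A) = Set.range (π.comp D.subtype) := by
      ext; exact Iff.rfl
    rw [hr]
    exact hiso.isClosedEmbedding.isClosed_range
  have hle : (StarAlgebra.adjoin ℂ (Set.range fun f => π (d f))).topologicalClosure ≤
      (π.comp D.subtype).range := by
    refine StarSubalgebra.topologicalClosure_minimal (StarAlgebra.adjoin_le ?_) hcl
    rintro _ ⟨f, rfl⟩
    exact ⟨⟨d f, StarSubalgebra.le_topologicalClosure _ (StarAlgebra.subset_adjoin ℂ _ ⟨f, rfl⟩)⟩,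
      rfl⟩
  rw [hgen] at hle
  exact hle (StarSubalgebra.mem_top (x := y))

/-- The isomorphism is the graph generated by the pairs `(a f, b f)` in `A × C`: these pairs satisfy
the relations, so both coordinate projections are bijective on the C⋆-algebra they generate. -/
theorem exists_starAlgEquiv [Nontrivial A] [Nontrivial C] {b : H →ₛₗ[starRingEnd ℂ] C}
    (ha : SatisfiesCAR a) (hb : SatisfiesCAR b)
    (ha' : (StarAlgebra.adjoin ℂ (Set.range a)).topologicalClosure = ⊤)
    (hb' : (StarAlgebra.adjoin ℂ (Set.range b)).topologicalClosure = ⊤) :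
    ∃ φ : A ≃⋆ₐ[ℂ] C, ∀ f, φ (a f) = b f := by
  let d : H →ₛₗ[starRingEnd ℂ] A × C :=
    { toFun := fun f => (a f, b f)
      map_add' := fun f g => by simp
      map_smul' := fun c f => by simp }
  have hd : SatisfiesCAR d :=
    ⟨fun f g => Prod.ext (ha.anticomm_star f g) (hb.anticomm_star f g),
      fun f g => Prod.ext (ha.anticomm f g) (hb.anticomm f g)⟩
  have h₁ := hd.bijective_comp_subtype (StarAlgHom.fst ℂ A C) ha'
  have h₂ := hd.bijective_comp_subtype (StarAlgHom.snd ℂ A C) hb'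
  refine ⟨(StarAlgEquiv.ofBijective _ h₁).symm.trans (StarAlgEquiv.ofBijective _ h₂), fun f => ?_⟩
  let x : (StarAlgebra.adjoin ℂ (Set.range d)).topologicalClosure :=
    ⟨d f, StarSubalgebra.le_topologicalClosure _ (StarAlgebra.subset_adjoin ℂ _ ⟨f, rfl⟩)⟩
  have hx : StarAlgEquiv.ofBijective _ h₁ x = a f := rfl
  rw [← hx, StarAlgEquiv.trans_apply, StarAlgEquiv.symm_apply_apply]
  rfl

end SatisfiesCAR

end Uniqueness

/-! ### The canonical action and its fixed points -/

section Action

variable {H : Type*} [NormedAddCommGroup H] [InnerProductSpace ℂ H] [CompleteSpace H]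
  {A : Type*} [CStarAlgebra A] {a : H →L⋆[ℂ] A}

namespace CARAlg.IsCARAlgebra

omit [CompleteSpace H] in
theorem satisfiesCAR (ha : IsCARAlgebra a) : SatisfiesCAR (a : H →ₛₗ[starRingEnd ℂ] A) :=
  ⟨ha.anticomm_star, ha.anticomm⟩

omit [CompleteSpace H] in
theorem closure_eq_univ (ha : IsCARAlgebra a) :
    closure (StarAlgebra.adjoin ℂ (Set.range a) : Set A) = Set.univ := by
  rw [← StarSubalgebra.topologicalClosure_coe, ha.generates]; rfl

theorem exists_starAlgEquiv_of_unitary (ha : IsCARAlgebra a) (U : unitary (H →L[ℂ] H)) :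
    ∃ φ : A ≃⋆ₐ[ℂ] A, ∀ f, φ (a f) = a ((U : H →L[ℂ] H) f) := by
  have := ha.nontrivial
  let b : H →ₛₗ[starRingEnd ℂ] A :=
    { toFun := fun f => a ((U : H →L[ℂ] H) f)
      map_add' := fun f g => by simp
      map_smul' := fun c f => by simp }
  have hb : SatisfiesCAR b := by
    refine ⟨fun f g => ?_, fun f g => ha.anticomm _ _⟩
    have h : ⟪(U : H →L[ℂ] H) f, (U : H →L[ℂ] H) g⟫_ℂ = ⟪f, g⟫_ℂ := Unitary.inner_map_map U f g
    rw [← h]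
    exact ha.anticomm_star _ _
  have hrange : Set.range b = Set.range a := by
    refine Set.Subset.antisymm (by rintro _ ⟨f, rfl⟩; exact ⟨_, rfl⟩) ?_
    rintro _ ⟨f, rfl⟩
    refine ⟨(star U : H →L[ℂ] H) f, ?_⟩
    have : (U : H →L[ℂ] H) ((star U : H →L[ℂ] H) f) = f :=
      DFunLike.congr_fun (Unitary.coe_mul_star_self U) f
    exact congrArg a this
  exact ha.satisfiesCAR.exists_starAlgEquiv hb ha.generates (by rw [hrange]; exact ha.generates)

theorem existsUnique_isCanonicalAction (ha : IsCARAlgebra a) :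
    ∃! α : unitary (H →L[ℂ] H) →* (A ≃⋆ₐ[ℂ] A), IsCanonicalAction a α := by
  have hext {φ ψ : A ≃⋆ₐ[ℂ] A} (h : ∀ f, φ (a f) = ψ (a f)) : φ = ψ :=
    starAlgEquiv_ext_of_adjoin ha.generates (by rintro _ ⟨f, rfl⟩; exact h f)
  choose α hα using ha.exists_starAlgEquiv_of_unitary
  refine ⟨{ toFun := α, map_one' := hext fun f => ?_, map_mul' := fun U V => hext fun f => ?_ },
    hα, fun β hβ => MonoidHom.ext fun U => hext fun f => ?_⟩
  · rw [hα]; rfl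
  · rw [hα, StarAlgEquiv.mul_apply, hα, hα]; rfl
  · exact (hβ U f).trans (hα U f).symm

end CARAlg.IsCARAlgebra

/-- For uniformly Lipschitz families of maps, pointwise convergence to zero extends from a dense
set. -/
theorem tendsto_zero_of_dense {X : Type*} {l : Filter X} {F : X → A → A} {K : ℝ} (hK : 0 ≤ K)
    (hF : ∀ U x y, ‖F U x - F U y‖ ≤ K * ‖x - y‖) {s : Set A} (hs : closure s = Set.univ)
    (h : ∀ x ∈ s, Tendsto (fun U => F U x) l (𝓝 0)) (x : A) :
    Tendsto (fun U => F U x) l (𝓝 0) := by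
  rw [Metric.tendsto_nhds]
  intro ε hε
  have hx : x ∈ closure s := by rw [hs]; trivial
  obtain ⟨y, hy, hxy⟩ := Metric.mem_closure_iff.1 hx (ε / (2 * (K + 1))) (by positivity)
  filter_upwards [Metric.tendsto_nhds.1 (h y hy) (ε / 2) (by positivity)] with U hU
  rw [dist_zero_right] at hU ⊢
  rw [dist_eq_norm, lt_div_iff₀ (by positivity)] at hxy
  have h1 := hF U x y
  have h2 := norm_le_norm_add_norm_sub' (F U x) (F U y)
  nlinarith [norm_nonneg (x - y)]

namespace CARAlg.IsCanonicalAction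

variable {α : unitary (H →L[ℂ] H) →* (A ≃⋆ₐ[ℂ] A)}

/-- The canonical action is strongly continuous. -/
theorem tendsto (hα : IsCanonicalAction a α) (ha : IsCARAlgebra a)
    {l : Filter (unitary (H →L[ℂ] H))} {V : unitary (H →L[ℂ] H)}
    (h : ∀ f, Tendsto (fun U : unitary (H →L[ℂ] H) => (U : H →L[ℂ] H) f) l
      (𝓝 ((V : H →L[ℂ] H) f))) (x : A) :
    Tendsto (fun U => α U x) l (𝓝 (α V x)) := by
  have hn (U) (x : A) : ‖α U x‖ = ‖x‖ := NonUnitalStarAlgHom.norm_map (α U) (α U).injective x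
  rw [← tendsto_sub_nhds_zero_iff]
  refine tendsto_zero_of_dense (F := fun U x => α U x - α V x) zero_le_two (fun U x y => ?_)
    ha.closure_eq_univ (fun x hx => tendsto_sub_nhds_zero_iff.2 ?_) x
  · have h1 := norm_sub_le (α U (x - y)) (α V (x - y))
    rw [hn, hn, map_sub, map_sub, sub_sub_sub_comm] at h1
    linarith
  · induction hx using StarAlgebra.adjoin_induction with
    | mem x hx =>
      obtain ⟨f, rfl⟩ := hx
      simp only [hα _ f]
      exact (a.continuous.tendsto _).comp (h f)
    | algebraMap c =>
      simp only [Algebra.algebraMap_eq_smul_one, map_smul, map_one]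
      exact tendsto_const_nhds
    | add x y _ _ h₁ h₂ => simpa only [map_add] using h₁.add h₂
    | mul x y _ _ h₁ h₂ => simpa only [map_mul] using h₁.mul h₂
    | star x _ h₁ => simpa only [map_star] using h₁.star

/-- If `U` tends weakly to zero, then `α U x` asymptotically commutes with `a g` up to the grading
automorphism `α (-1)`. On generators this holds as `a (U f) (a g) + (a g) a (U f) = 0` and
`(a (U f))⋆ (a g) + (a g) (a (U f))⋆ = ⟪g, U f⟫`. -/
theorem tendsto_mul_sub_mul (hα : IsCanonicalAction a α) (ha : IsCARAlgebra a)
    {l : Filter (unitary (H →L[ℂ] H))}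
    (h : ∀ f g, Tendsto (fun U : unitary (H →L[ℂ] H) => ⟪f, (U : H →L[ℂ] H) g⟫_ℂ) l (𝓝 0))
    (g : H) (x : A) :
    Tendsto (fun U => α U x * a g - a g * α U (α (-1) x)) l (𝓝 0) := by
  have hn (U) (x : A) : ‖α U x‖ = ‖x‖ := NonUnitalStarAlgHom.norm_map (α U) (α U).injective x
  refine tendsto_zero_of_dense (F := fun U x => α U x * a g - a g * α U (α (-1) x))
    (K := 2 * ‖a g‖) (by positivity) (fun U x y => ?_) ha.closure_eq_univ (fun x hx => ?_) x
  · have h1 : α U x * a g - a g * α U (α (-1) x) - (α U y * a g - a g * α U (α (-1) y)) =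
        α U (x - y) * a g - a g * α U (α (-1) (x - y)) := by
      simp only [map_sub, sub_mul, mul_sub]; abel
    rw [h1]
    refine (norm_sub_le _ _).trans ?_
    have h2 := norm_mul_le (α U (x - y)) (a g)
    have h3 := norm_mul_le (a g) (α U (α (-1) (x - y)))
    rw [hn] at h2
    rw [hn, hn] at h3
    linarith
  · have hθ (f : H) : α (-1) (a f) = -a f := by
      rw [hα, ← map_neg]; rfl
    rw [SetLike.mem_coe, ← StarSubalgebra.mem_toSubalgebra, StarAlgebra.adjoin_toSubalgebra] at hx
    induction hx using Algebra.adjoin_induction with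
    | mem x hx =>
      rcases hx with ⟨f, rfl⟩ | ⟨f, hf⟩
      · refine tendsto_const_nhds.congr fun U => ?_
        rw [hθ, map_neg, hα, mul_neg, sub_neg_eq_add, ha.anticomm]
      · have hx' : x = star (a f) := by rw [hf, star_star]
        have h1 := (h g f).smul_const (1 : A)
        rw [zero_smul] at h1
        refine h1.congr fun U => ?_
        rw [hx', map_star, map_star, map_star, hθ, map_neg, hα, star_neg, mul_neg, sub_neg_eq_add,
          add_comm, ha.anticomm_star]
    | algebraMap c =>
      refine tendsto_const_nhds.congr fun U => ?_
      simp only [Algebra.algebraMap_eq_smul_one, map_smul, map_one]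
      simp
    | add x y _ _ h₁ h₂ =>
      have h3 := h₁.add h₂
      rw [add_zero] at h3
      refine h3.congr fun U => ?_
      simp only [map_add, add_mul, mul_add]; abel
    | mul x y _ _ h₁ h₂ =>
      have h3 := (h₂.norm.const_mul ‖x‖).add (h₁.norm.mul_const ‖y‖)
      rw [norm_zero, mul_zero, zero_mul, add_zero] at h3
      refine squeeze_zero_norm (fun U => ?_) h3
      have h4 : α U (x * y) * a g - a g * α U (α (-1) (x * y)) =
          α U x * (α U y * a g - a g * α U (α (-1) y)) +
            (α U x * a g - a g * α U (α (-1) x)) * α U (α (-1) y) := by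
        simp only [map_mul, mul_sub, sub_mul, mul_assoc]; abel
      rw [h4]
      refine (norm_add_le _ _).trans (add_le_add ((norm_mul_le _ _).trans_eq ?_)
        ((norm_mul_le _ _).trans_eq ?_))
      · rw [hn]
      · rw [hn, hn]

theorem fixedPointAlgebra_bicommutant (hα : IsCanonicalAction a α) (ha : IsCARAlgebra a)
    (𝒜 : StarSubalgebra ℂ (H →L[ℂ] H)) (hcl : IsClosed (𝒜 : Set (H →L[ℂ] H))) :
    fixedPointAlgebra α (𝒜 : Set (H →L[ℂ] H)) =
      fixedPointAlgebra α (bicommutant (𝒜 : Set (H →L[ℂ] H))) := by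
  refine le_antisymm (fun x hx V hV => ?_)
    fun x hx U hU => hx U (Set.subset_centralizer_centralizer hU)
  obtain ⟨l, hl, hmem, hlim⟩ := exists_filter_tendsto_of_mem_bicommutant 𝒜 hcl V hV
  refine tendsto_nhds_unique (hα.tendsto ha hlim x) (tendsto_const_nhds.congr' ?_)
  filter_upwards [hmem] with U hU using (hx U hU).symm

/-- Fixed points are even, as `-1 ∈ N`, so that they commute with all `a g`: let `U ∈ N` tend weakly
to zero. Hence they are central. -/
theorem fixedPointAlgebra_eq_bot (hα : IsCanonicalAction a α) (ha : IsCARAlgebra a)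
    (N : VonNeumannAlgebra H) (hna : IsNonatomic N) :
    fixedPointAlgebra α (N : Set (H →L[ℂ] H)) = ⊥ := by
  obtain ⟨l, hl, hmem, hlim⟩ := exists_filter_inner_tendsto_zero N hna
  have hcomm : ∀ x ∈ fixedPointAlgebra α (N : Set (H →L[ℂ] H)), ∀ g, x * a g = a g * x := by
    intro x hx g
    have hθ : α (-1) x = x := hx (-1) (neg_mem (one_mem N))
    rw [← sub_eq_zero]
    refine tendsto_nhds_unique (tendsto_const_nhds.congr' ?_) (hα.tendsto_mul_sub_mul ha hlim g x)
    filter_upwards [hmem] with U hU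
    rw [hθ, hx U hU]
  refine le_bot_iff.1 fun x hx => ha.satisfiesCAR.mem_bot_of_forall_commute ha.generates fun y => ?_
  have hle : (StarAlgebra.adjoin ℂ (Set.range a)).topologicalClosure ≤
      StarSubalgebra.centralizer ℂ {x} := by
    refine StarSubalgebra.topologicalClosure_minimal (StarAlgebra.adjoin_le ?_)
      (by rw [StarSubalgebra.coe_centralizer]; exact Set.isClosed_centralizer _)
    rintro _ ⟨g, rfl⟩
    rw [SetLike.mem_coe, StarSubalgebra.mem_centralizer_iff]
    rintro _ rfl
    exact ⟨hcomm _ hx g, hcomm _ (star_mem hx) g⟩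
  rw [ha.generates] at hle
  exact (((StarSubalgebra.mem_centralizer_iff ℂ).1 (hle (StarSubalgebra.mem_top (x := y)))) x
    rfl).1.symm

end CARAlg.IsCanonicalAction

end Action

theorem mainTheorem7 {H : Type*} [NormedAddCommGroup H] [InnerProductSpace ℂ H]
    [CompleteSpace H] {A : Type*} [CStarAlgebra A] (a : H →L⋆[ℂ] A)
    (ha : CARAlg.IsCARAlgebra a) :
    (∃! α : unitary (H →L[ℂ] H) →* (A ≃⋆ₐ[ℂ] A), CARAlg.IsCanonicalAction a α) ∧
    ∀ α : unitary (H →L[ℂ] H) →* (A ≃⋆ₐ[ℂ] A), CARAlg.IsCanonicalAction a α →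
      ∀ 𝒜 : StarSubalgebra ℂ (H →L[ℂ] H), IsClosed (𝒜 : Set (H →L[ℂ] H)) →
        CARAlg.fixedPointAlgebra α (𝒜 : Set (H →L[ℂ] H)) =
            CARAlg.fixedPointAlgebra α (CARAlg.bicommutant (𝒜 : Set (H →L[ℂ] H))) ∧
        ((∃ N : VonNeumannAlgebra H, CARAlg.IsCommutative N ∧ CARAlg.IsNonatomic N ∧
            (N : Set (H →L[ℂ] H)) ⊆ CARAlg.bicommutant (𝒜 : Set (H →L[ℂ] H))) →
          CARAlg.fixedPointAlgebra α (𝒜 : Set (H →L[ℂ] H)) = ⊥) := by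
  refine ⟨ha.existsUnique_isCanonicalAction, fun α hα 𝒜 hcl => ?_⟩
  have h := hα.fixedPointAlgebra_bicommutant ha 𝒜 hcl
  refine ⟨h, ?_⟩
  rintro ⟨N, -, hna, hsub⟩
  rw [h, ← le_bot_iff, ← hα.fixedPointAlgebra_eq_bot ha N hna]
  exact fun x hx U hU => hx U (hsub hU)
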